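/- Consider a preemptive last-come first-served GI/GI/1 queue: packets, each time-stamped with its arrival time, arrive at a single server with non-negative i.i.d. interarrival times distributed as $G$, and have non-negative i.i.d. service times distributed as $H$, independent of the interarrival times. Each packet enters service on arrival, interrupting the service in progress, and an interrupted packet never updates the displayed information. A packet whose service is completed before the next arrival (an informative packet) updates the displayed information at its completion. The age of information is $A_t = t - \eta_t$, where $\eta_t$ is the time-stamp of the information displayed at time $t$; the initial state of the queue and the initially displayed time-stamp are arbitrary. Let $G$ and $H$ be independent and assume $E[G]<\infty$, $\Pr(G=H)=0$ and $\zeta := \Pr(G<H)\in(0,1)$. Write $y^*(s)=E[e^{-sY}]$ for the Laplace–Stieltjes transform of a non-negative random variable $Y$. Let $H_{<G}$ be distributed as $H$ conditioned on $H<G$, let $G_{<H}$ be distributed as $G$ conditioned on $G<H$, and let $\tilde G$ be the residual interarrival time, with density $\Pr(G>x)/E[G]$ on $[0,\infty)$, so that $\tilde g^*(s)=\frac{1-g^*(s)}{sE[G]}$ for $s>0$. Then the age of information has a stationary distribution, i.e. there is a non-negative random variable $A$ such that, with probability one, $\frac1T\int_0^T \mathbf 1_{\{A_t\le x\}}\,dt\to\Pr(A\le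 x)$ as $T\to\infty$ for all $x$; if the law of $A_t$ does not depend on $t\ge 0$, then $A_t$ is distributed as $A$ for every $t\ge0$. Moreover: (i) For all $s>0$, $$a^*(s) = h_{<G}^*(s)\cdot\tilde g^*(s)\cdot\frac{1-\zeta}{1-\zeta g_{<H}^*(s)}.$$ (ii) If $E[G^2]<\infty$, then $E[A]<\infty$, $$E[A] = E[H_{<G}] + \frac{E[G^2]}{2E[G]} + \frac{\zeta}{1-\zeta}E[G_{<H}],$$ and $\frac1T\int_0^T A_t\,dt\to E[A]$ with probability one as $T\to\infty$. (iii) $A$ is equal in distribution to the sum $H_{<G}+\tilde G+Z$ of three independent random variables. Here $Z$ has the law of the time from the arrival of any packet, apart from those belonging to the initial state, to the arrival of the next informative packet (zero if the packet itself is informative); $Z$ is distributed as $\sum_{i=1}^{K} G_{<H}^{[i]}$ with $\Pr(K=k)=(1-\zeta)\zeta^k$ ($k=0,1,\dots$) and with i.i.d. copies $G_{<H}^{[i]}$ of $G_{<H}$ independent of $K$; and $z^*(s)=\frac{1-\zeta}{1-\zeta g_{<H}^*(s)}$ for $s>0$. -/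

import Mathlib

open MeasureTheory ProbabilityTheory Filter Topology Set

noncomputable section

/-! ### Sample paths of the preemptive last-come first-served single-server queue

A sample path is given by the arrival time `τ` of packet `0`, the interarrival times
`g n` between packets `n` and `n + 1`, the service times `h n`, and the time-stamp `e` of the
information initially on display. -/

/-- Arrival time (and time-stamp) of packet `n`. -/
def arrival (τ : ℝ) (g : ℕ → ℝ) (n : ℕ) : ℝ :=
  τ + ∑ i ∈ Finset.range n, g i

/-- Every packet enters service at its arrival, so packet `n` would complete at `departure n`. -/
def departure (τ : ℝ) (g h : ℕ → ℝ) (n : ℕ) : ℝ :=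
  arrival τ g n + h n

/-- Packet `n` is informative: the next arrival does not preempt its service, i.e. does not
occur before its completion. -/
def Informative (τ : ℝ) (g h : ℕ → ℝ) (n : ℕ) : Prop :=
  departure τ g h n ≤ arrival τ g (n + 1)

/-- Time-stamp of the information on display at time `t`: that of the newest packet
delivered by time `t`, and the initial one as long as there is no newer one. -/
def displayedStamp (e τ : ℝ) (g h : ℕ → ℝ) (t : ℝ) : ℝ :=
  sSup (insert e
    {x | ∃ n, Informative τ g h n ∧ departure τ g h n ≤ t ∧ x = arrival τ g n})

/-- The age of information at time `t`. -/
def ageOfInformation (e τ : ℝ) (g h : ℕ → ℝ) (t : ℝ) : ℝ :=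
  t - displayedStamp e τ g h t

/-- Time from the arrival of packet `n` to the arrival of the next informative packet
(which is packet `n` itself if it is informative). -/
def timeToInformative (τ : ℝ) (g h : ℕ → ℝ) (n : ℕ) : ℝ :=
  arrival τ g (sInf {k | n ≤ k ∧ Informative τ g h k}) - arrival τ g n

/-! ### Laws built from the interarrival law `μG` and the service law `μH` -/

/-- Laplace-Stieltjes transform of a law. -/
def lst (μ : Measure ℝ) (s : ℝ) : ℝ :=
  ∫ x, Real.exp (-s * x) ∂μ

/-- `ζ = Pr(G < H)` for independent `G`, `H`. -/
def preemptProb (μG μH : Measure ℝ) : ℝ :=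
  (μG.prod μH).real {p | p.1 < p.2}

/-- Law of `H` given `H < G`. -/
def lawHltG (μG μH : Measure ℝ) : Measure ℝ :=
  (cond (μG.prod μH) {p | p.2 < p.1}).map Prod.snd

/-- Law of `G` given `G < H`. -/
def lawGltH (μG μH : Measure ℝ) : Measure ℝ :=
  (cond (μG.prod μH) {p | p.1 < p.2}).map Prod.fst

/-- Residual (equilibrium) law: density `Pr(G > x) / E[G]` on `[0, ∞)`. -/
def residualLaw (μG : Measure ℝ) : Measure ℝ :=
  (volume.restrict (Ici 0)).withDensity
    (fun x => μG (Ioi x) / ENNReal.ofReal (∫ y, y ∂μG))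

/-- Law of `Y₁ + ⋯ + Y_K`, where `Y₁, Y₂, …` have law `μ`, `Pr(K = k) = (1 - z) z ^ k` for
`k = 0, 1, 2, …`, and `K, Y₁, Y₂, …` are independent. -/
def geometricCompound (z : ℝ) (μ : Measure ℝ) : Measure ℝ :=
  Measure.sum fun k : ℕ =>
    ENNReal.ofReal ((1 - z) * z ^ k) •
      (Measure.pi fun _ : Fin k => μ).map fun y => ∑ i, y i

end

/-! The argument is renewal-reward, packet by packet. If the displayed information has age `c` when
a packet arrives, then over the following interarrival interval of length `g` the age is `c + v` for
`v < min g h` and `v` afterwards, so the integral of `φ` of the age is `cycleReward φ c (g, h)`. The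
age `c` at successive arrivals follows the recursion `staleness`: add `g`, and drop the old value if
the packet was informative. Its value depends only on earlier packets, hence is independent of the
current pair `(g, h)`.

For `φ x = exp (-s * x)` the reward is affine in `Y = exp (-s * c)`, and `Y` obeys a random affine
recursion. A strong law for martingale transforms (`strong_law_predictable`, resting on Rajchman's
law for orthogonal variables) replaces the random coefficients by their means, so the average `y` of
`Y` solves `y = a + b * y` with `b = ζ * lst (lawGltH μG μH) s`. Dividing the average reward by the
mean interarrival time yields the product of three transforms (`ae_tendsto_average_reward_exp`,
`tendsto_average_age`). The same scheme with `φ x = x` gives the mean; there the staleness is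
unbounded, and a uniform second-moment bound (`exists_bound_staleness_sq`) takes the place of
boundedness.

The stationary law is defined as the convolution of the three claimed laws, so its transform and
mean are computed factor by factor. To pass from transforms to distribution functions, push
everything forward by `exp (-x)` into `[0, 1]`: transforms at natural numbers become moments, which
determine weak limits by Weierstrass, and the limit has no atoms because the residual law has a
density. A time-invariant law must equal this limit by averaging over `Ω`. The law of `Z` is found
by expanding its characteristic function over the number of preempted packets. -/

/-! ### Convolutions of laws on the line -/

section Convolution

theorem integral_conv_of_multiplicative {μ ν : Measure ℝ} [SFinite μ] [SFinite ν] {f : ℝ → ℝ}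
    (hf : Measurable f) (hadd : ∀ x y, f (x + y) = f x * f y) :
    ∫ x, f x ∂(μ.conv ν) = (∫ x, f x ∂μ) * ∫ x, f x ∂ν := by
  rw [Measure.conv, integral_map (by fun_prop) hf.aestronglyMeasurable]
  simp_rw [hadd]
  exact integral_prod_mul f f

theorem lst_conv (μ ν : Measure ℝ) [SFinite μ] [SFinite ν] (s : ℝ) :
    lst (μ.conv ν) s = lst μ s * lst ν s :=
  integral_conv_of_multiplicative (by fun_prop) fun x y => by rw [← Real.exp_add]; ring_nf

theorem integrable_id_conv {μ ν : Measure ℝ} [IsProbabilityMeasure μ] [IsProbabilityMeasure ν]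
    (hμ : Integrable (fun x : ℝ => x) μ) (hν : Integrable (fun x : ℝ => x) ν) :
    Integrable (fun x : ℝ => x) (μ.conv ν) := by
  rw [Measure.conv, integrable_map_measure (by fun_prop) (by fun_prop)]
  exact (hμ.comp_fst ν).add (hν.comp_snd μ)

theorem integral_id_conv {μ ν : Measure ℝ} [IsProbabilityMeasure μ] [IsProbabilityMeasure ν]
    (hμ : Integrable (fun x : ℝ => x) μ) (hν : Integrable (fun x : ℝ => x) ν) :
    ∫ x, x ∂(μ.conv ν) = (∫ x, x ∂μ) + ∫ x, x ∂ν := by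
  rw [Measure.conv, integral_map (by fun_prop) (by fun_prop),
    integral_add (hμ.comp_fst ν) (hν.comp_snd μ), integral_fun_fst (fun x : ℝ => x),
    integral_fun_snd (fun x : ℝ => x)]
  simp

/-- By Fubini, one atomless factor suffices. Atomlessness of the stationary law is what gives
convergence of distribution functions at every point. -/
theorem conv_singleton_eq_zero {μ ν : Measure ℝ} [SFinite μ] [SFinite ν]
    (hν : ∀ x, ν {x} = 0) (x : ℝ) : (μ.conv ν) {x} = 0 := by
  rw [Measure.conv, Measure.map_apply (by fun_prop) (measurableSet_singleton x),
    Measure.measure_prod_null (measurableSet_singleton x |>.preimage (by fun_prop))]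
  refine Eventually.of_forall fun y => ?_
  have : Prod.mk y ⁻¹' ((fun p : ℝ × ℝ => p.1 + p.2) ⁻¹' {x}) = {x - y} := by
    ext z
    simp only [mem_preimage, mem_singleton_iff]
    constructor <;> intro h <;> linarith
  simpa only [this, Pi.zero_apply] using hν _

theorem ae_nonneg_conv {μ ν : Measure ℝ} [SFinite μ] [SFinite ν]
    (hμ : ∀ᵐ x ∂μ, 0 ≤ x) (hν : ∀ᵐ x ∂ν, 0 ≤ x) : ∀ᵐ x ∂(μ.conv ν), 0 ≤ x := by
  rw [Measure.conv, ae_map_iff (by fun_prop) measurableSet_Ici]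
  filter_upwards [Measure.quasiMeasurePreserving_fst.ae hμ,
    Measure.quasiMeasurePreserving_snd.ae hν] with p h1 h2 using add_nonneg h1 h2

end Convolution

/-! ### Geometric compound sums: transform, characteristic function, mean -/

section GeometricCompound

variable {𝕜 : Type*} [RCLike 𝕜] {μ : Measure ℝ} [IsProbabilityMeasure μ] {z : ℝ}

theorem measurable_coord_sum (k : ℕ) : Measurable fun y : Fin k → ℝ => ∑ i, y i := by fun_prop

theorem ae_coord_sum_nonneg (hμ : ∀ᵐ x ∂μ, 0 ≤ x) (k : ℕ) :
    ∀ᵐ x ∂((Measure.pi fun _ : Fin k => μ).map fun y => ∑ i, y i), 0 ≤ x := by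
  rw [ae_map_iff (measurable_coord_sum k).aemeasurable measurableSet_Ici]
  have h : ∀ i : Fin k, ∀ᵐ y ∂(Measure.pi fun _ : Fin k => μ), 0 ≤ y i := fun i =>
    (measurePreserving_eval (fun _ : Fin k => μ) i).quasiMeasurePreserving.ae hμ
  filter_upwards [ae_all_iff.2 h] with y hy using Finset.sum_nonneg fun i _ => hy i

theorem ae_nonneg_geometricCompound (hμ : ∀ᵐ x ∂μ, 0 ≤ x) :
    ∀ᵐ x ∂(geometricCompound z μ), 0 ≤ x := by
  rw [geometricCompound, Measure.ae_sum_iff]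
  exact fun k => Measure.ae_smul_measure (ae_coord_sum_nonneg hμ k) _

theorem isProbabilityMeasure_geometricCompound (h0 : 0 ≤ z) (h1 : z < 1) :
    IsProbabilityMeasure (geometricCompound z μ) := by
  constructor
  have hp : ∀ k : ℕ, ((Measure.pi fun _ : Fin k => μ).map fun y => ∑ i, y i) univ = 1 :=
    fun k => by
      rw [Measure.map_apply (measurable_coord_sum k) MeasurableSet.univ]; simp
  rw [geometricCompound, Measure.sum_apply _ MeasurableSet.univ]
  simp only [Measure.smul_apply, hp, smul_eq_mul, mul_one]
  rw [← ENNReal.ofReal_tsum_of_nonneg (fun k => mul_nonneg (by linarith) (pow_nonneg h0 k))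
    ((summable_geometric_of_lt_one h0 h1).mul_left _), tsum_mul_left,
    tsum_geometric_of_lt_one h0 h1, mul_inv_cancel₀ (by linarith), ENNReal.ofReal_one]

theorem integral_coord_sum {f : ℝ → 𝕜} (hf : Measurable f)
    (hadd : ∀ x y, f (x + y) = f x * f y) (hzero : f 0 = 1) (k : ℕ) :
    ∫ x, f x ∂((Measure.pi fun _ : Fin k => μ).map fun y => ∑ i, y i) = (∫ x, f x ∂μ) ^ k := by
  rw [integral_map (measurable_coord_sum k).aemeasurable hf.aestronglyMeasurable]
  have h : ∀ y : Fin k → ℝ, f (∑ i, y i) = ∏ i, f (y i) := fun y => by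
    induction (Finset.univ : Finset (Fin k)) using Finset.induction_on with
    | empty => simpa using hzero
    | insert a t ha ih => rw [Finset.sum_insert ha, Finset.prod_insert ha, hadd, ih]
  simp_rw [h]
  rw [integral_fintype_prod_eq_prod (fun _ => f)]
  simp

/-- Multiplicativity turns the `k`-fold sum into a `k`-th power, leaving a geometric series. The
scalar field is generic so that real exponentials (transform) and complex ones (characteristic
function) are both covered. -/
theorem integral_geometricCompound {f : ℝ → 𝕜} (hf : Measurable f)
    (hadd : ∀ x y, f (x + y) = f x * f y) (hzero : f 0 = 1) (hbound : ∀ x, 0 ≤ x → ‖f x‖ ≤ 1)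
    (hμ : ∀ᵐ x ∂μ, 0 ≤ x) (h0 : 0 ≤ z) (h1 : z < 1) :
    ∫ x, f x ∂(geometricCompound z μ) = (1 - (z : 𝕜)) / (1 - (z : 𝕜) * ∫ x, f x ∂μ) := by
  have := isProbabilityMeasure_geometricCompound (μ := μ) h0 h1
  have hint : Integrable f (geometricCompound z μ) :=
    Integrable.of_bound hf.aestronglyMeasurable 1
      ((ae_nonneg_geometricCompound hμ).mono fun x hx => hbound x hx)
  have hm : ‖∫ x, f x ∂μ‖ ≤ 1 := by
    simpa using norm_integral_le_of_norm_le_const (μ := μ) (hμ.mono fun x hx => hbound x hx)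
  have hzm : ‖(z : 𝕜) * ∫ x, f x ∂μ‖ < 1 := by
    rw [norm_mul, RCLike.norm_ofReal, abs_of_nonneg h0]
    exact (mul_le_of_le_one_right h0 hm).trans_lt h1
  have hs := hasSum_integral_measure (show Integrable f (Measure.sum _) from hint)
  rw [geometricCompound, ← hs.tsum_eq, div_eq_mul_inv, ← tsum_geometric_of_norm_lt_one hzm,
    ← tsum_mul_left]
  congr 1
  funext k
  rw [integral_smul_measure, integral_coord_sum hf hadd hzero,
    ENNReal.toReal_ofReal (mul_nonneg (by linarith) (pow_nonneg h0 k)), RCLike.real_smul_eq_coe_mul]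
  push_cast
  ring

theorem lst_geometricCompound (hμ : ∀ᵐ x ∂μ, 0 ≤ x) (h0 : 0 ≤ z) (h1 : z < 1) {s : ℝ}
    (hs : 0 ≤ s) : lst (geometricCompound z μ) s = (1 - z) / (1 - z * lst μ s) := by
  refine integral_geometricCompound (𝕜 := ℝ) (by fun_prop) (fun x y => ?_) (by simp)
    (fun x hx => ?_) hμ h0 h1
  · rw [← Real.exp_add]; ring_nf
  · rw [Real.norm_eq_abs, Real.abs_exp, Real.exp_le_one_iff]
    nlinarith

theorem charFun_geometricCompound (hμ : ∀ᵐ x ∂μ, 0 ≤ x) (h0 : 0 ≤ z) (h1 : z < 1) (t : ℝ) :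
    charFun (geometricCompound z μ) t = (1 - (z : ℂ)) / (1 - (z : ℂ) * charFun μ t) := by
  simp only [charFun_apply_real]
  refine integral_geometricCompound (𝕜 := ℂ) (by fun_prop) (fun x y => ?_) (by simp)
    (fun x hx => ?_) hμ h0 h1
  · rw [← Complex.exp_add]; push_cast; ring_nf
  · rw [← Complex.ofReal_mul, Complex.norm_exp_ofReal_mul_I]

/-- The `k`-th component has first absolute moment at most `k` times that of `μ`, so both
integrability and the value come from the series `∑ k * z ^ k`. -/
theorem integral_id_geometricCompound (hint : Integrable (fun x : ℝ => x) μ)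
    (h0 : 0 ≤ z) (h1 : z < 1) :
    Integrable (fun x : ℝ => x) (geometricCompound z μ) ∧
      ∫ x, x ∂(geometricCompound z μ) = z / (1 - z) * ∫ x, x ∂μ := by
  have hcoord : ∀ (k : ℕ) (i : Fin k),
      Integrable (fun y : Fin k → ℝ => y i) (Measure.pi fun _ : Fin k => μ) := fun k i =>
    (measurePreserving_eval (fun _ : Fin k => μ) i).integrable_comp_of_integrable hint
  have hcoord_int : ∀ (k : ℕ) (i : Fin k) (f : ℝ → ℝ), Measurable f →
      ∫ y, f (y i) ∂(Measure.pi fun _ : Fin k => μ) = ∫ x, f x ∂μ := fun k i f hf => by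
    have h := (measurePreserving_eval (fun _ : Fin k => μ) i).map_eq
    conv_rhs => rw [← h]
    rw [integral_map (measurable_pi_apply i).aemeasurable hf.aestronglyMeasurable]
  have hk : ∀ k : ℕ, Integrable (fun x : ℝ => x)
      ((Measure.pi fun _ : Fin k => μ).map fun y => ∑ i, y i) := fun k => by
    rw [integrable_map_measure (by fun_prop) (measurable_coord_sum k).aemeasurable]
    exact integrable_finsetSum _ fun i _ => hcoord k i
  have hkm : ∀ k : ℕ, ∫ x, x ∂((Measure.pi fun _ : Fin k => μ).map fun y => ∑ i, y i) =
      k * ∫ x, x ∂μ := fun k => by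
    rw [integral_map (measurable_coord_sum k).aemeasurable (by fun_prop),
      integral_finsetSum _ fun i _ => hcoord k i]
    simp [hcoord_int k _ (fun x => x) measurable_id]
  have hkn : ∀ k : ℕ, ∫ x, ‖x‖ ∂((Measure.pi fun _ : Fin k => μ).map fun y => ∑ i, y i) ≤
      k * ∫ x, ‖x‖ ∂μ := fun k => by
    rw [integral_map (measurable_coord_sum k).aemeasurable (by fun_prop)]
    calc ∫ y : Fin k → ℝ, ‖∑ i, y i‖ ∂(Measure.pi fun _ : Fin k => μ)
        ≤ ∫ y : Fin k → ℝ, ∑ i, ‖y i‖ ∂(Measure.pi fun _ : Fin k => μ) :=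
          integral_mono (integrable_finsetSum _ fun i _ => hcoord k i).norm
            (integrable_finsetSum _ fun i _ => (hcoord k i).norm)
            fun y => norm_sum_le _ _
      _ = k * ∫ x, ‖x‖ ∂μ := by
          rw [integral_finsetSum _ fun i _ => (hcoord k i).norm]
          simp only [hcoord_int k _ (fun x => ‖x‖) measurable_norm]
          simp
  have hw : ∀ k : ℕ, (ENNReal.ofReal ((1 - z) * z ^ k)).toReal = (1 - z) * z ^ k := fun k =>
    ENNReal.toReal_ofReal (mul_nonneg (by linarith) (pow_nonneg h0 k))
  have hz : ‖z‖ < 1 := by rwa [Real.norm_of_nonneg h0]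
  have hint' : Integrable (fun x : ℝ => x) (geometricCompound z μ) := by
    refine integrable_sum_measure (fun k => (hk k).smul_measure ENNReal.ofReal_ne_top) ?_
    refine Summable.of_nonneg_of_le (fun k => integral_nonneg fun _ => norm_nonneg _) (fun k => ?_)
      (((hasSum_coe_mul_geometric_of_norm_lt_one hz).summable.mul_left (1 - z)).mul_right
        (∫ x, ‖x‖ ∂μ))
    rw [integral_smul_measure, hw, smul_eq_mul]
    calc _ ≤ (1 - z) * z ^ k * (k * ∫ x, ‖x‖ ∂μ) :=
          mul_le_mul_of_nonneg_left (hkn k) (mul_nonneg (by linarith) (pow_nonneg h0 k))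
      _ = _ := by ring
  refine ⟨hint', ?_⟩
  have hs := hasSum_integral_measure (show Integrable (fun x : ℝ => x) (Measure.sum _) from hint')
  rw [geometricCompound, ← hs.tsum_eq]
  have : ∀ k : ℕ, ∫ x, x ∂(ENNReal.ofReal ((1 - z) * z ^ k) •
      ((Measure.pi fun _ : Fin k => μ).map fun y => ∑ i, y i)) =
      (1 - z) * (k * z ^ k) * ∫ x, x ∂μ := fun k => by
    rw [integral_smul_measure, hw, smul_eq_mul, hkm]; ring
  simp_rw [this]
  rw [tsum_mul_right, tsum_mul_left, tsum_coe_mul_geometric_of_norm_lt_one hz]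
  have : (1 - z) ≠ 0 := by linarith
  field_simp

end GeometricCompound

/-! ### The residual interarrival law -/

section Residual

variable {μ : Measure ℝ} [IsProbabilityMeasure μ]

omit [IsProbabilityMeasure μ] in
-- Layer-cake formula: integrating `f` against the tail of `μ` is integrating the primitive of `f`
-- against `μ`. The choices `1`, `exp (-s * x)` and `x` for `f` give total mass, transform and mean.
theorem lintegral_residualLaw (hμ : ∀ᵐ x ∂μ, 0 ≤ x) {f : ℝ → ℝ} (hf : Continuous f)
    (hf0 : ∀ x, 0 ≤ x → 0 ≤ f x) :
    ∫⁻ x, ENNReal.ofReal (f x) ∂(residualLaw μ) =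
      (∫⁻ y, ENNReal.ofReal (∫ t in (0 : ℝ)..y, f t) ∂μ) / ENNReal.ofReal (∫ y, y ∂μ) := by
  have hm : Measurable fun x : ℝ => μ (Ioi x) :=
    (antitone_iff_forall_lt.2 fun a b hab => measure_mono (Ioi_subset_Ioi hab.le)).measurable
  have h := lintegral_comp_eq_lintegral_meas_lt_mul μ (f := fun x => x) (g := f) hμ
    measurable_id.aemeasurable (fun t _ => hf.intervalIntegrable 0 t)
    ((ae_restrict_iff' measurableSet_Ioi).2 (Eventually.of_forall fun x hx => hf0 x (le_of_lt hx)))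
  rw [h, residualLaw, lintegral_withDensity_eq_lintegral_mul _ (hm.div_const _) (by fun_prop),
    div_eq_mul_inv, ← lintegral_mul_const _ (by
      exact Measurable.mul hm (by fun_prop)), setLIntegral_congr Ioi_ae_eq_Ici]
  refine lintegral_congr fun x => ?_
  simp only [Pi.mul_apply, div_eq_mul_inv]
  rw [mul_right_comm]; rfl

omit [IsProbabilityMeasure μ] in
theorem ae_nonneg_residualLaw : ∀ᵐ x ∂(residualLaw μ), 0 ≤ x :=
  (withDensity_absolutelyContinuous _ _).ae_le (ae_restrict_mem measurableSet_Ici)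

omit [IsProbabilityMeasure μ] in
theorem residualLaw_singleton (x : ℝ) : residualLaw μ {x} = 0 :=
  (withDensity_absolutelyContinuous _ _)
    (Measure.absolutelyContinuous_of_le Measure.restrict_le_self (measure_singleton x))

omit [IsProbabilityMeasure μ] in
theorem isProbabilityMeasure_residualLaw (hμ : ∀ᵐ x ∂μ, 0 ≤ x)
    (hint : Integrable (fun x : ℝ => x) μ) (hpos : 0 < ∫ x, x ∂μ) :
    IsProbabilityMeasure (residualLaw μ) := by
  constructor
  have h := lintegral_residualLaw hμ (f := fun _ => 1) continuous_const (fun _ _ => zero_le_one)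
  simp only [ENNReal.ofReal_one, lintegral_one, intervalIntegral.integral_const,
    sub_zero, smul_eq_mul, mul_one] at h
  rw [h, ← ofReal_integral_eq_lintegral_ofReal hint hμ]
  exact ENNReal.div_self (by simpa using hpos) ENNReal.ofReal_ne_top

omit [IsProbabilityMeasure μ] in
theorem integral_residualLaw (hμ : ∀ᵐ x ∂μ, 0 ≤ x) (hpos : 0 < ∫ x, x ∂μ)
    {f : ℝ → ℝ} (hf : Continuous f) (hf0 : ∀ x, 0 ≤ x → 0 ≤ f x)
    (hF : Integrable (fun y => ∫ t in (0 : ℝ)..y, f t) μ) :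
    Integrable f (residualLaw μ) ∧
      ∫ x, f x ∂(residualLaw μ) = (∫ y, (∫ t in (0 : ℝ)..y, f t) ∂μ) / ∫ y, y ∂μ := by
  have hF0 : 0 ≤ᵐ[μ] fun y => ∫ t in (0 : ℝ)..y, f t := hμ.mono fun y hy =>
    intervalIntegral.integral_nonneg hy fun t ht => hf0 t ht.1
  have hr0 : 0 ≤ᵐ[residualLaw μ] f := ae_nonneg_residualLaw.mono fun x hx => hf0 x hx
  have h := lintegral_residualLaw hμ hf hf0
  rw [← ofReal_integral_eq_lintegral_ofReal hF hF0, ← ENNReal.ofReal_div_of_pos hpos] at h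
  have hi : Integrable f (residualLaw μ) :=
    (lintegral_ofReal_ne_top_iff_integrable hf.aestronglyMeasurable hr0).1
      (by rw [h]; exact ENNReal.ofReal_ne_top)
  refine ⟨hi, ?_⟩
  rw [integral_eq_lintegral_of_nonneg_ae hr0 hf.aestronglyMeasurable, h, ENNReal.toReal_ofReal]
  exact div_nonneg (integral_nonneg_of_ae hF0) hpos.le

theorem integral_exp_neg_mul {s : ℝ} (hs : s ≠ 0) (a b : ℝ) :
    ∫ t in a..b, Real.exp (-s * t) = (Real.exp (-s * a) - Real.exp (-s * b)) / s := by
  rw [intervalIntegral.integral_comp_mul_left (fun x => Real.exp x) (neg_ne_zero.2 hs),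
    integral_exp, smul_eq_mul]
  field_simp
  ring

theorem integrable_exp_neg_mul (hμ : ∀ᵐ x ∂μ, 0 ≤ x) {s : ℝ} (hs : 0 ≤ s) :
    Integrable (fun x => Real.exp (-s * x)) μ :=
  Integrable.of_bound (by fun_prop) 1 (hμ.mono fun x hx => by
    rw [Real.norm_eq_abs, Real.abs_exp, Real.exp_le_one_iff]; nlinarith)

theorem lst_residualLaw (hμ : ∀ᵐ x ∂μ, 0 ≤ x) (hpos : 0 < ∫ x, x ∂μ) {s : ℝ} (hs : 0 < s) :
    lst (residualLaw μ) s = (1 - lst μ s) / (s * ∫ x, x ∂μ) := by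
  have hF : (fun y => ∫ t in (0 : ℝ)..y, Real.exp (-s * t)) =
      fun y => (1 - Real.exp (-s * y)) / s := by
    funext y; rw [integral_exp_neg_mul hs.ne']; simp
  have hi := integrable_exp_neg_mul hμ hs.le
  rw [lst, (integral_residualLaw hμ hpos (by fun_prop) (fun _ _ => (Real.exp_pos _).le)
    (by rw [hF]; exact ((integrable_const 1).sub hi).div_const s)).2, hF, integral_div,
    integral_sub (integrable_const 1) hi, div_div]
  simp [lst]

omit [IsProbabilityMeasure μ] in
theorem integral_id_residualLaw (hμ : ∀ᵐ x ∂μ, 0 ≤ x) (hpos : 0 < ∫ x, x ∂μ)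
    (h2 : Integrable (fun x : ℝ => x ^ 2) μ) :
    Integrable (fun x : ℝ => x) (residualLaw μ) ∧
      ∫ x, x ∂(residualLaw μ) = (∫ x, x ^ 2 ∂μ) / (2 * ∫ x, x ∂μ) := by
  have hF : (fun y => ∫ t in (0 : ℝ)..y, t) = fun y => y ^ 2 / 2 := by
    funext y; rw [integral_id]; ring
  obtain ⟨h, h'⟩ := integral_residualLaw hμ hpos continuous_id (fun _ h => h)
    (by simp only [id]; rw [hF]; exact h2.div_const 2)
  refine ⟨h, h'.trans ?_⟩
  simp only [id]
  rw [hF, integral_div, div_div]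

end Residual

/-! ### Laws conditioned on preemption or completion -/

section ConditionalLaws

variable {μG μH : Measure ℝ} [IsProbabilityMeasure μG] [IsProbabilityMeasure μH]

theorem measurableSet_fst_lt_snd : MeasurableSet {p : ℝ × ℝ | p.1 < p.2} :=
  measurableSet_lt measurable_fst measurable_snd

theorem measurableSet_snd_lt_fst : MeasurableSet {p : ℝ × ℝ | p.2 < p.1} :=
  measurableSet_lt measurable_snd measurable_fst

theorem real_snd_lt_fst (htie : (μG.prod μH) {p | p.1 = p.2} = 0) :
    (μG.prod μH).real {p | p.2 < p.1} = 1 - preemptProb μG μH := by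
  have h : {p : ℝ × ℝ | p.2 < p.1} =ᵐ[μG.prod μH] ({p | p.1 < p.2}ᶜ : Set (ℝ × ℝ)) := by
    have : ∀ᵐ p ∂(μG.prod μH), p.1 ≠ p.2 := by simpa [ae_iff] using htie
    refine eventuallyEq_set.2 (this.mono fun p hp => ?_)
    simp only [mem_compl_iff, mem_ofPred_eq, not_lt]
    exact ⟨le_of_lt, fun h => lt_of_le_of_ne h hp.symm⟩
  rw [measureReal_congr h, probReal_compl_eq_one_sub measurableSet_fst_lt_snd, preemptProb]

theorem isProbabilityMeasure_lawHltG (htie : (μG.prod μH) {p | p.1 = p.2} = 0)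
    (hζ : preemptProb μG μH < 1) : IsProbabilityMeasure (lawHltG μG μH) := by
  have : (μG.prod μH) {p | p.2 < p.1} ≠ 0 := fun h => by
    have := real_snd_lt_fst htie
    rw [measureReal_def, h, ENNReal.toReal_zero] at this
    linarith
  have := cond_isProbabilityMeasure this
  exact Measure.isProbabilityMeasure_map measurable_snd.aemeasurable

theorem isProbabilityMeasure_lawGltH (hζ : 0 < preemptProb μG μH) :
    IsProbabilityMeasure (lawGltH μG μH) := by
  have : (μG.prod μH) {p | p.1 < p.2} ≠ 0 := fun h => by
    rw [preemptProb, measureReal_def, h, ENNReal.toReal_zero] at hζ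
    exact lt_irrefl _ hζ
  have := cond_isProbabilityMeasure this
  exact Measure.isProbabilityMeasure_map measurable_fst.aemeasurable

theorem integral_cond {Ω E : Type*} [MeasurableSpace Ω] [NormedAddCommGroup E] [NormedSpace ℝ E]
    (μ : Measure Ω) (s : Set Ω) (f : Ω → E) :
    ∫ x, f x ∂(ProbabilityTheory.cond μ s) = (μ.real s)⁻¹ • ∫ x in s, f x ∂μ := by
  rw [ProbabilityTheory.cond, integral_smul_measure, ENNReal.toReal_inv, measureReal_def]

variable {E : Type*} [NormedAddCommGroup E] [NormedSpace ℝ E]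

/-- The probability of the conditioning event stays on the left, which is the form in which the
averages over packets produce these integrals. -/
theorem integral_lawHltG (htie : (μG.prod μH) {p | p.1 = p.2} = 0)
    (hζ : preemptProb μG μH < 1) {f : ℝ → E} (hf : StronglyMeasurable f) :
    (1 - preemptProb μG μH) • ∫ x, f x ∂(lawHltG μG μH) =
      ∫ p in {p | p.2 < p.1}, f p.2 ∂(μG.prod μH) := by
  rw [lawHltG, integral_map measurable_snd.aemeasurable hf.aestronglyMeasurable, integral_cond,
    real_snd_lt_fst htie, smul_inv_smul₀ (by linarith)]

omit [IsProbabilityMeasure μG] [IsProbabilityMeasure μH] in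
theorem integral_lawGltH (hζ : 0 < preemptProb μG μH) {f : ℝ → E} (hf : StronglyMeasurable f) :
    preemptProb μG μH • ∫ x, f x ∂(lawGltH μG μH) =
      ∫ p in {p | p.1 < p.2}, f p.1 ∂(μG.prod μH) := by
  rw [lawGltH, integral_map measurable_fst.aemeasurable hf.aestronglyMeasurable, integral_cond,
    ← preemptProb, smul_inv_smul₀ hζ.ne']

omit [IsProbabilityMeasure μG] [IsProbabilityMeasure μH] in
theorem ae_lawHltG {q : ℝ → Prop} (hq : MeasurableSet {x | q x})
    (h : ∀ᵐ p ∂(μG.prod μH), q p.2) : ∀ᵐ x ∂(lawHltG μG μH), q x := by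
  rw [lawHltG, ae_map_iff measurable_snd.aemeasurable hq]
  exact Measure.ae_smul_measure (ae_restrict_of_ae h) _

omit [IsProbabilityMeasure μG] [IsProbabilityMeasure μH] in
theorem ae_lawGltH {q : ℝ → Prop} (hq : MeasurableSet {x | q x})
    (h : ∀ᵐ p ∂(μG.prod μH), q p.1) : ∀ᵐ x ∂(lawGltH μG μH), q x := by
  rw [lawGltH, ae_map_iff measurable_fst.aemeasurable hq]
  exact Measure.ae_smul_measure (ae_restrict_of_ae h) _

theorem integrable_cond {Ω : Type*} [MeasurableSpace Ω] {μ : Measure Ω} {s : Set Ω} {f : Ω → ℝ}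
    (hs : μ s ≠ 0) (hf : IntegrableOn f s μ) : Integrable f (ProbabilityTheory.cond μ s) :=
  Integrable.smul_measure hf (ENNReal.inv_ne_top.2 hs)

omit [IsProbabilityMeasure μG] in
theorem integrable_id_lawGltH (hζ : 0 < preemptProb μG μH) (hG : Integrable (fun x : ℝ => x) μG) :
    Integrable (fun x : ℝ => x) (lawGltH μG μH) := by
  rw [lawGltH, integrable_map_measure (by fun_prop) measurable_fst.aemeasurable]
  refine integrable_cond (fun h => ?_) (hG.comp_fst μH).integrableOn
  rw [preemptProb, measureReal_def, h, ENNReal.toReal_zero] at hζ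
  exact lt_irrefl _ hζ

/-- Service times may have infinite mean, but on the conditioning event `H` is dominated by `G`. -/
theorem integrable_id_lawHltG (htie : (μG.prod μH) {p | p.1 = p.2} = 0)
    (hζ : preemptProb μG μH < 1) (hH0 : ∀ᵐ x ∂μH, 0 ≤ x) (hG : Integrable (fun x : ℝ => x) μG) :
    Integrable (fun x : ℝ => x) (lawHltG μG μH) := by
  rw [lawHltG, integrable_map_measure (by fun_prop) measurable_snd.aemeasurable]
  refine integrable_cond (fun h => ?_) ?_
  · have := real_snd_lt_fst htie
    rw [measureReal_def, h, ENNReal.toReal_zero] at this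
    linarith
  · refine Integrable.mono (hG.comp_fst μH).integrableOn (by fun_prop) ?_
    filter_upwards [ae_restrict_mem measurableSet_snd_lt_fst,
      ae_restrict_of_ae (Measure.quasiMeasurePreserving_snd.ae hH0)] with p hp h0
    simp only [Function.comp_apply] at *
    rw [Real.norm_of_nonneg h0]
    exact hp.le.trans (le_abs_self _)

end ConditionalLaws
-- Strong laws for orthogonal variables and martingale transforms
section StrongLaws

variable {Ω : Type*} [MeasurableSpace Ω] {P : Measure Ω} [IsProbabilityMeasure P]

omit [IsProbabilityMeasure P] in
-- The series of squares has finite expectation, so it converges almost everywhere and its terms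
-- vanish.
theorem ae_tendsto_zero_of_summable_integral_sq {f : ℕ → Ω → ℝ} {c : ℕ → ℝ}
    (hf : ∀ k, MemLp (f k) 2 P) (hfc : ∀ k, ∫ ω, f k ω ^ 2 ∂P ≤ c k) (hc : Summable c) :
    ∀ᵐ ω ∂P, Tendsto (fun k => f k ω) atTop (𝓝 0) := by
  have hc0 : ∀ k, 0 ≤ c k := fun k => (integral_nonneg fun _ => sq_nonneg _).trans (hfc k)
  have hm : ∀ k, AEMeasurable (fun ω => ENNReal.ofReal (f k ω ^ 2)) P := fun k =>
    ((hf k).aestronglyMeasurable.aemeasurable.pow_const 2).ennreal_ofReal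
  have hsum : ∫⁻ ω, ∑' k, ENNReal.ofReal (f k ω ^ 2) ∂P ≠ ⊤ := by
    rw [lintegral_tsum hm]
    refine ne_top_of_le_ne_top (ENNReal.ofReal_ne_top (r := ∑' k, c k)) ?_
    rw [ENNReal.ofReal_tsum_of_nonneg hc0 hc]
    refine ENNReal.tsum_le_tsum fun k => ?_
    rw [← ofReal_integral_eq_lintegral_ofReal (hf k).integrable_sq
      (Eventually.of_forall fun _ => sq_nonneg _)]
    exact ENNReal.ofReal_le_ofReal (hfc k)
  filter_upwards [ae_lt_top' (AEMeasurable.tsum hm) hsum] with ω hω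
  have h1 := ENNReal.tendsto_atTop_zero_of_tsum_ne_top hω.ne
  have h2 := (ENNReal.tendsto_toReal ENNReal.zero_ne_top).comp h1
  have h3 : Tendsto (fun k => f k ω ^ 2) atTop (𝓝 0) := by
    refine h2.congr fun k => ?_
    simp [ENNReal.toReal_ofReal (sq_nonneg (f k ω))]
  have h4 := h3.sqrt
  simp only [Real.sqrt_sq_eq_abs, Real.sqrt_zero] at h4
  exact (tendsto_zero_iff_abs_tendsto_zero _).2 h4

omit [IsProbabilityMeasure P] in
/-- Rajchman's strong law of large numbers for orthogonal variables bounded in `L²`. -/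
theorem strong_law_of_orthogonal {X : ℕ → Ω → ℝ} {M : ℝ} (hX : ∀ n, MemLp (X n) 2 P)
    (hM : ∀ n, ∫ ω, X n ω ^ 2 ∂P ≤ M)
    (horth : ∀ i j, i < j → ∫ ω, X i ω * X j ω ∂P = 0) :
    ∀ᵐ ω ∂P, Tendsto (fun N : ℕ => (∑ i ∈ Finset.range N, X i ω) / N) atTop (𝓝 0) := by
  have hint : ∀ i j, Integrable (fun ω => X i ω * X j ω) P := fun i j =>
    (hX i).integrable_mul (hX j)
  have hM0 : 0 ≤ M := (integral_nonneg fun _ => sq_nonneg _).trans (hM 0)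
  -- Orthogonality kills the cross terms, so the second moment of the partial sum grows only
  -- linearly.
  have hS : ∀ N : ℕ, ∫ ω, (∑ i ∈ Finset.range N, X i ω) ^ 2 ∂P ≤ N * M := by
    intro N
    simp_rw [sq, Finset.sum_mul_sum]
    rw [integral_finsetSum _ fun i _ => integrable_finsetSum _ fun j _ => hint i j]
    calc _ ≤ ∑ i ∈ Finset.range N, M := ?_
      _ = N * M := by simp
    refine Finset.sum_le_sum fun i hi => ?_
    rw [integral_finsetSum _ fun j _ => hint i j, Finset.sum_eq_single i]
    · simpa [sq] using hM i
    · intro j _ hji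
      rcases lt_or_gt_of_ne hji with h | h
      · rw [← horth j i h]; simp_rw [mul_comm]
      · exact horth i j h
    · exact fun h => absurd hi h
  -- Cauchy–Schwarz over the `2 * k + 1` indices between consecutive squares controls the
  -- oscillation inside a block.
  have hD : ∀ k : ℕ, ∫ ω, (∑ i ∈ Finset.Ico (k ^ 2) ((k + 1) ^ 2), |X i ω|) ^ 2 ∂P ≤
      (2 * k + 1) ^ 2 * M := by
    intro k
    have hcard : ((Finset.Ico (k ^ 2) ((k + 1) ^ 2)).card : ℝ) = 2 * k + 1 := by
      rw [Nat.card_Ico, Nat.cast_sub (Nat.pow_le_pow_left (Nat.le_succ k) 2)]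
      push_cast; ring
    calc ∫ ω, (∑ i ∈ Finset.Ico (k ^ 2) ((k + 1) ^ 2), |X i ω|) ^ 2 ∂P
        ≤ ∫ ω, (2 * k + 1) * ∑ i ∈ Finset.Ico (k ^ 2) ((k + 1) ^ 2), X i ω ^ 2 ∂P := by
          refine integral_mono ?_ ?_ fun ω => ?_
          · exact (memLp_finsetSum _ fun i _ => (hX i).abs).integrable_sq
          · exact (integrable_finsetSum _ fun i _ => (hX i).integrable_sq).const_mul _
          · have := sq_sum_le_card_mul_sum_sq (s := Finset.Ico (k ^ 2) ((k + 1) ^ 2))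
              (f := fun i => |X i ω|)
            simpa only [sq_abs, hcard] using this
      _ ≤ (2 * k + 1) * ∑ i ∈ Finset.Ico (k ^ 2) ((k + 1) ^ 2), M := by
          rw [integral_const_mul, integral_finsetSum _ fun i _ => (hX i).integrable_sq]
          gcongr with i
          exact hM i
      _ = (2 * k + 1) ^ 2 * M := by
          rw [Finset.sum_const, nsmul_eq_mul, hcard]; ring
  have hsummable : ∀ a : ℝ, Summable fun k : ℕ => a / (k : ℝ) ^ 2 := fun a => by
    simp_rw [div_eq_mul_inv]
    exact (Real.summable_nat_pow_inv.2 one_lt_two).mul_left a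
  -- Along the squares the averages have second moment at most `M / k ^ 2`, which is summable. The
  -- constant `9` for the block terms below is `(2 * k + 1) ^ 2 ≤ 9 * k ^ 2` for `k ≥ 1`.
  have h1 := ae_tendsto_zero_of_summable_integral_sq (P := P)
    (f := fun k ω => (∑ i ∈ Finset.range (k ^ 2), X i ω) / (k : ℝ) ^ 2)
    (c := fun k => M / (k : ℝ) ^ 2)
    (fun k => by
      simpa only [div_eq_inv_mul] using
        (memLp_finsetSum _ fun i _ => hX i).const_mul (((k : ℝ) ^ 2)⁻¹))
    (fun k => by
      simp_rw [div_pow]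
      rw [integral_div]
      rcases Nat.eq_zero_or_pos k with rfl | hk
      · simp
      · have hk' : (0 : ℝ) < k := by exact_mod_cast hk
        rw [div_le_div_iff₀ (by positivity) (by positivity)]
        have := hS (k ^ 2)
        push_cast at this
        nlinarith [mul_le_mul_of_nonneg_right this (sq_nonneg (k : ℝ))])
    (hsummable M)
  have h2 := ae_tendsto_zero_of_summable_integral_sq (P := P)
    (f := fun k ω => (∑ i ∈ Finset.Ico (k ^ 2) ((k + 1) ^ 2), |X i ω|) / (k : ℝ) ^ 2)
    (c := fun k => (9 * M) / (k : ℝ) ^ 2)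
    (fun k => by
      simpa only [div_eq_inv_mul, Real.norm_eq_abs] using
        (memLp_finsetSum _ fun i _ => (hX i).norm).const_mul (((k : ℝ) ^ 2)⁻¹))
    (fun k => by
      simp_rw [div_pow]
      rw [integral_div]
      rcases Nat.eq_zero_or_pos k with rfl | hk
      · simp
      · have hk' : (1 : ℝ) ≤ k := by exact_mod_cast hk
        have h9 : (2 * (k : ℝ) + 1) ^ 2 ≤ 9 * k ^ 2 := by nlinarith
        rw [div_le_div_iff₀ (by positivity) (by positivity)]
        have := (hD k).trans (mul_le_mul_of_nonneg_right h9 hM0)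
        nlinarith [mul_le_mul_of_nonneg_right this (sq_nonneg (k : ℝ))])
    (hsummable _)
  filter_upwards [h1, h2] with ω h1 h2
  have hsqrt : Tendsto Nat.sqrt atTop atTop :=
    tendsto_atTop_atTop.2 fun b => ⟨b * b, fun a ha => Nat.le_sqrt.2 ha⟩
  have h3 := ((h1.abs.add h2).comp hsqrt)
  rw [abs_zero, add_zero] at h3
  refine squeeze_zero_norm' ?_ h3
  filter_upwards [eventually_ge_atTop 1] with N hN
  -- A general `N` is compared with the last square below it; the excess is absorbed by the block
  -- sum.
  set k := Nat.sqrt N with hkdef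
  have hk1 : 1 ≤ k := Nat.le_sqrt.2 (by simpa using hN)
  have hkN : k ^ 2 ≤ N := Nat.sqrt_le' N
  have hNk : N < (k + 1) ^ 2 := Nat.lt_succ_sqrt' N
  have hk0 : (0 : ℝ) < (k : ℝ) ^ 2 := by positivity
  have hkN' : (k : ℝ) ^ 2 ≤ N := by exact_mod_cast hkN
  rw [Function.comp_apply, ← hkdef, Real.norm_eq_abs, abs_div, Nat.abs_cast, abs_div,
    abs_of_nonneg hk0.le, ← add_div]
  have hsplit : |∑ i ∈ Finset.range N, X i ω| ≤ |∑ i ∈ Finset.range (k ^ 2), X i ω| +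
      ∑ i ∈ Finset.Ico (k ^ 2) ((k + 1) ^ 2), |X i ω| := by
    rw [← Finset.sum_range_add_sum_Ico _ hkN]
    refine (abs_add_le _ _).trans (add_le_add_right ?_ _)
    refine (Finset.abs_sum_le_sum_abs _ _).trans ?_
    exact Finset.sum_le_sum_of_subset_of_nonneg (Finset.Ico_subset_Ico_right hNk.le)
      fun _ _ _ => abs_nonneg _
  calc _ ≤ (|∑ i ∈ Finset.range (k ^ 2), X i ω| +
      ∑ i ∈ Finset.Ico (k ^ 2) ((k + 1) ^ 2), |X i ω|) / N := by gcongr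
    _ ≤ _ := by
      refine div_le_div_of_nonneg_left ?_ hk0 hkN'
      exact add_nonneg (abs_nonneg _) (Finset.sum_nonneg fun _ _ => abs_nonneg _)

variable {S : Type*} [MeasurableSpace S]

/-- The σ-algebra generated by `X 0, …, X (n - 1)`. -/
@[reducible]
def strictPast (X : ℕ → Ω → S) (n : ℕ) : MeasurableSpace Ω :=
  ⨆ i ∈ Iio n, MeasurableSpace.comap (X i) inferInstance

theorem strictPast_le {X : ℕ → Ω → S} (hX : ∀ n, Measurable (X n)) (n : ℕ) :
    strictPast X n ≤ ‹MeasurableSpace Ω› :=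
  iSup₂_le fun i _ => (hX i).comap_le

omit [MeasurableSpace Ω] in
theorem strictPast_mono (X : ℕ → Ω → S) {m n : ℕ} (h : m ≤ n) : strictPast X m ≤ strictPast X n :=
  biSup_mono fun _ hi => lt_of_lt_of_le hi h

omit [MeasurableSpace Ω] in
theorem measurable_strictPast (X : ℕ → Ω → S) {m n : ℕ} (h : m < n) :
    Measurable[strictPast X n] (X m) :=
  Measurable.mono (comap_measurable (X m)) (le_iSup₂_of_le m h le_rfl) le_rfl

omit [IsProbabilityMeasure P] in
-- The index sets `Iio n` and `{n}` are disjoint, so the σ-algebras they generate are independent.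
theorem indepFun_of_strictPast {X : ℕ → Ω → S} (hX : ∀ n, Measurable (X n))
    (hind : iIndepFun X P) {β : Type*} [MeasurableSpace β] {V : Ω → β} {n : ℕ}
    (hV : Measurable[strictPast X n] V) : IndepFun V (X n) P := by
  have h := indep_iSup_of_disjoint (fun i => (hX i).comap_le) hind.iIndep
    (S := Iio n) (T := {n}) (by simp)
  rw [iSup_singleton] at h
  exact (IndepFun_iff_Indep V (X n) P).2 (indep_of_indep_of_le_left h hV.comap_le)

omit [IsProbabilityMeasure P] in
theorem strong_law_comp {X : ℕ → Ω → S} (hX : ∀ n, Measurable (X n)) (hind : iIndepFun X P)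
    {ρ : Measure S} (hlaw : ∀ n, P.map (X n) = ρ) {f : S → ℝ} (hf : Measurable f)
    (hfi : Integrable f ρ) :
    ∀ᵐ ω ∂P, Tendsto (fun N : ℕ => (∑ i ∈ Finset.range N, f (X i ω)) / N) atTop
      (𝓝 (∫ x, f x ∂ρ)) := by
  have h := strong_law_ae_real (μ := P) (fun n ω => f (X n ω))
    (by rw [← hlaw 0] at hfi; exact hfi.comp_measurable (hX 0))
    (fun i j hij => (hind.indepFun hij).comp hf hf)
    (fun i => (IdentDistrib.mk (hX i).aemeasurable (hX 0).aemeasurable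
      ((hlaw i).trans (hlaw 0).symm)).comp hf)
  rwa [← integral_map (hX 0).aemeasurable hf.aestronglyMeasurable, hlaw 0] at h

/-- Strong law for martingale transforms: `W n` depends on `X 0, …, X (n - 1)` only. -/
theorem strong_law_predictable {X : ℕ → Ω → S} (hX : ∀ n, Measurable (X n))
    (hind : iIndepFun X P) {ρ : Measure S} (hlaw : ∀ n, P.map (X n) = ρ)
    {W : ℕ → Ω → ℝ} (hW : ∀ n, Measurable[strictPast X n] (W n)) (hW2 : ∀ n, MemLp (W n) 2 P)
    {M : ℝ} (hWM : ∀ n, ∫ ω, W n ω ^ 2 ∂P ≤ M) {f : S → ℝ} (hf : Measurable f)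
    (hf2 : MemLp f 2 ρ) :
    ∀ᵐ ω ∂P, Tendsto
      (fun N : ℕ => (∑ n ∈ Finset.range N, W n ω * (f (X n ω) - ∫ x, f x ∂ρ)) / N)
      atTop (𝓝 0) := by
  have : IsProbabilityMeasure ρ := hlaw 0 ▸ Measure.isProbabilityMeasure_map (hX 0).aemeasurable
  set c := ∫ x, f x ∂ρ with hc
  have hg : Measurable fun x => f x - c := hf.sub_const c
  have hg2 : ∀ n, MemLp (fun ω => f (X n ω) - c) 2 P := fun n => by
    have : MemLp (fun x => f x - c) 2 (P.map (X n)) := by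
      rw [hlaw n]; exact hf2.sub (memLp_const c)
    exact (memLp_map_measure_iff hg.aestronglyMeasurable (hX n).aemeasurable).1 this
  have hgint : ∀ n, ∫ ω, (f (X n ω) - c) ∂P = 0 := fun n => by
    rw [← integral_map (hX n).aemeasurable (f := fun x => f x - c) hg.aestronglyMeasurable, hlaw n,
      integral_sub (hf2.integrable (by norm_num)) (integrable_const c)]
    simp [hc]
  have hgsq : ∀ n, ∫ ω, (f (X n ω) - c) ^ 2 ∂P = ∫ x, (f x - c) ^ 2 ∂ρ := fun n => by
    rw [← hlaw n, integral_map (hX n).aemeasurable (hg.pow_const 2).aestronglyMeasurable]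
  have hWm : ∀ n, Measurable (W n) := fun n => (hW n).mono (strictPast_le hX n) le_rfl
  have hindsq : ∀ n, IndepFun (fun ω => W n ω ^ 2) (fun ω => (f (X n ω) - c) ^ 2) P := fun n =>
    (indepFun_of_strictPast hX hind (hW n)).comp (measurable_id.pow_const 2) (hg.pow_const 2)
  have hprod2 : ∀ n, MemLp (fun ω => W n ω * (f (X n ω) - c)) 2 P := fun n => by
    have hm : Measurable fun ω => W n ω * (f (X n ω) - c) := (hWm n).mul (hg.comp (hX n))
    rw [memLp_two_iff_integrable_sq hm.aestronglyMeasurable]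
    simp_rw [mul_pow]
    exact (hindsq n).integrable_mul (hW2 n).integrable_sq (hg2 n).integrable_sq
  refine strong_law_of_orthogonal (M := M * ∫ x, (f x - c) ^ 2 ∂ρ) hprod2 (fun n => ?_)
    fun i j hij => ?_
  · simp_rw [mul_pow]
    rw [(hindsq n).integral_fun_mul_eq_mul_integral (hW2 n).integrable_sq.aestronglyMeasurable
      (hg2 n).integrable_sq.aestronglyMeasurable, hgsq]
    exact mul_le_mul_of_nonneg_right (hWM n) (integral_nonneg fun _ => sq_nonneg _)
  -- For `i < j`, everything except the last centred factor is known before time `j`, so the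
  -- expectation factors and the centred factor contributes zero.
  · have hV : Measurable[strictPast X j] fun ω => W i ω * (f (X i ω) - c) * W j ω := by
      refine Measurable.mul (Measurable.mul ?_ ?_) (hW j)
      · exact (hW i).mono (strictPast_mono X hij.le) le_rfl
      · exact hg.comp (measurable_strictPast X hij)
    have hindep : IndepFun (fun ω => W i ω * (f (X i ω) - c) * W j ω)
        (fun ω => f (X j ω) - c) P :=
      (indepFun_of_strictPast hX hind hV).comp measurable_id hg
    simp_rw [← mul_assoc]
    rw [hindep.integral_fun_mul_eq_mul_integral
      (hV.mono (strictPast_le hX j) le_rfl).aestronglyMeasurable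
      (hg.comp (hX j)).aestronglyMeasurable, hgint, mul_zero]

end StrongLaws
-- Sample-path analysis of the age
section SamplePath

/-- For `a m ≤ T < a (m + 1)`, monotonicity puts `I T / T` between `I (a m) / a (m + 1)` and `I (a
(m + 1)) / a m`. Both bounds have limit `L / c`. -/
theorem tendsto_inv_mul_of_tendsto_div {a : ℕ → ℝ} {I : ℝ → ℝ} {c L : ℝ} (ha : Monotone a)
    (hac : Tendsto (fun n : ℕ => a n / n) atTop (𝓝 c)) (hc : 0 < c)
    (hI : MonotoneOn I (Ici 0)) (hI0 : ∀ T, 0 ≤ T → 0 ≤ I T)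
    (hIa : Tendsto (fun n : ℕ => I (a n) / n) atTop (𝓝 L)) :
    Tendsto (fun T : ℝ => T⁻¹ * I T) atTop (𝓝 (L / c)) := by
  have hatop : Tendsto a atTop atTop := by
    refine (hac.pos_mul_atTop hc tendsto_natCast_atTop_atTop).congr' ?_
    filter_upwards [eventually_gt_atTop 0] with n hn
    have : (n : ℝ) ≠ 0 := by exact_mod_cast hn.ne'
    field_simp
  have hex : ∀ T : ℝ, ∃ n, T < a n := fun T => (hatop.eventually_gt_atTop T).exists
  classical
  -- The index of the last `a n` not exceeding `T`; the truncated subtraction is harmless once `a 0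
  -- ≤ T`.
  let m : ℝ → ℕ := fun T => Nat.find (hex T) - 1
  have hm : Tendsto m atTop atTop := by
    refine tendsto_atTop.2 fun b => ?_
    filter_upwards [eventually_ge_atTop (a b)] with T hT
    have : b < Nat.find (hex T) := by
      by_contra h
      exact absurd (Nat.find_spec (hex T)) (not_lt.2 ((ha (not_lt.1 h)).trans hT))
    simp only [m]; omega
  have hbounds : ∀ᶠ T in atTop, 0 < a (m T) ∧ a (m T) ≤ T ∧ T < a (m T + 1) ∧ 0 < m T := by
    filter_upwards [eventually_ge_atTop (a 0), hm.eventually (hatop.eventually_gt_atTop 0),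
      hm.eventually_gt_atTop 0] with T h0 h1 h3
    have hpos : 0 < Nat.find (hex T) := by
      rw [Nat.find_pos]; exact not_lt.2 h0
    refine ⟨h1, not_lt.1 (Nat.find_min (hex T) (by simp only [m]; omega)), ?_, h3⟩
    have : m T + 1 = Nat.find (hex T) := by simp only [m]; omega
    rw [this]
    exact Nat.find_spec (hex T)
  have hratio : Tendsto (fun n : ℕ => ((n + 1 : ℕ) : ℝ) / n) atTop (𝓝 1) := by
    have h := tendsto_one_div_atTop_nhds_zero_nat (𝕜 := ℝ)
    have h2 : Tendsto (fun n : ℕ => 1 + 1 / (n : ℝ)) atTop (𝓝 1) := by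
      simpa using h.const_add 1
    refine h2.congr' ?_
    filter_upwards [eventually_gt_atTop 0] with n hn
    have : (n : ℝ) ≠ 0 := by exact_mod_cast hn.ne'
    push_cast
    field_simp
  have hup : Tendsto (fun n : ℕ => I (a (n + 1)) / a n) atTop (𝓝 (L / c)) := by
    have h := (((tendsto_add_atTop_iff_nat 1).2 hIa).mul hratio).div hac hc.ne'
    rw [mul_one] at h
    refine h.congr' ?_
    filter_upwards [eventually_gt_atTop 0, hatop.eventually_gt_atTop 0] with n hn han
    have : (n : ℝ) ≠ 0 := by exact_mod_cast hn.ne'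
    have : ((n + 1 : ℕ) : ℝ) ≠ 0 := by positivity
    simp only [Pi.div_apply]
    field_simp
  have hlow : Tendsto (fun n : ℕ => I (a n) / a (n + 1)) atTop (𝓝 (L / c)) := by
    have h := hIa.div (((tendsto_add_atTop_iff_nat 1).2 hac).mul hratio) (by simpa using hc.ne')
    rw [mul_one] at h
    refine h.congr' ?_
    filter_upwards [eventually_gt_atTop 0,
      (tendsto_add_atTop_iff_nat 1).2 hatop |>.eventually_gt_atTop 0] with n hn han
    have : (n : ℝ) ≠ 0 := by exact_mod_cast hn.ne'
    have : ((n + 1 : ℕ) : ℝ) ≠ 0 := by positivity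
    simp only [Pi.div_apply]
    field_simp
  refine tendsto_of_tendsto_of_tendsto_of_le_of_le' (hlow.comp hm) (hup.comp hm) ?_ ?_
  · filter_upwards [hbounds] with T ⟨h1, h2, h3, h4⟩
    rw [Function.comp_apply, ← div_eq_inv_mul]
    exact div_le_div₀ (hI0 T (h1.le.trans h2)) (hI h1.le (h1.le.trans h2) h2) (h1.trans_le h2) h3.le
  · filter_upwards [hbounds] with T ⟨h1, h2, h3, h4⟩
    rw [Function.comp_apply, ← div_eq_inv_mul]
    have h5 : 0 ≤ T := h1.le.trans h2
    have h6 : 0 ≤ a (m T + 1) := h5.trans h3.le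
    exact div_le_div₀ (hI0 _ h6) (hI h5 h6 h3.le) h1 h2

/-- Age, at the arrival of packet `n + 1`, of the information on display once an informative
packet has been seen, in terms of `x k`, the interarrival and service times of packet `k + 1`. -/
noncomputable def staleness (x : ℕ → ℝ × ℝ) : ℕ → ℝ
  | 0 => 0
  | n + 1 => (x n).1 + if (x n).1 < (x n).2 then staleness x n else 0

theorem staleness_nonneg {x : ℕ → ℝ × ℝ} (hx : ∀ n, 0 ≤ (x n).1) (n : ℕ) : 0 ≤ staleness x n := by
  induction n with
  | zero => exact le_rfl
  | succ n ih =>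
    rw [staleness]
    split_ifs
    · exact add_nonneg (hx n) ih
    · simpa using hx n

variable {e τ : ℝ} {g h : ℕ → ℝ}

theorem arrival_succ (τ : ℝ) (g : ℕ → ℝ) (n : ℕ) : arrival τ g (n + 1) = arrival τ g n + g n := by
  rw [arrival, arrival, Finset.sum_range_succ, add_assoc]

theorem monotone_arrival (hg : ∀ n, 0 ≤ g n) : Monotone (arrival τ g) :=
  monotone_nat_of_le_succ fun n => by rw [arrival_succ]; linarith [hg n]

theorem informative_iff (n : ℕ) : Informative τ g h n ↔ h n ≤ g n := by
  rw [Informative, departure, arrival_succ, add_le_add_iff_left]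

/-- A packet delivered by time `t` arrived by time `t`. This makes the supremum in `displayedStamp`
a true one rather than the default value of `sSup`. -/
theorem bddAbove_stamps (hh : ∀ n, 0 ≤ h n) (t : ℝ) : max e t ∈ upperBounds (insert e
    {x | ∃ n, Informative τ g h n ∧ departure τ g h n ≤ t ∧ x = arrival τ g n}) := by
  rintro y (rfl | ⟨n, -, hd, rfl⟩)
  · exact le_max_left _ _
  · refine le_max_of_le_right (le_trans ?_ hd)
    rw [departure]; linarith [hh n]

theorem displayedStamp_le (hh : ∀ n, 0 ≤ h n) (t : ℝ) : displayedStamp e τ g h t ≤ max e t :=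
  csSup_le (insert_nonempty _ _) (bddAbove_stamps hh t)

theorem monotone_displayedStamp (hh : ∀ n, 0 ≤ h n) : Monotone (displayedStamp e τ g h) :=
  fun _ t hst => csSup_le_csSup ⟨_, bddAbove_stamps hh t⟩ (insert_nonempty _ _)
    (insert_subset_insert fun _ ⟨n, hi, hd, hx⟩ => ⟨n, hi, hd.trans hst, hx⟩)

theorem ageOfInformation_nonneg (he : e ≤ 0) (hh : ∀ n, 0 ≤ h n) {t : ℝ} (ht : 0 ≤ t) :
    0 ≤ ageOfInformation e τ g h t := by
  have := displayedStamp_le (e := e) (τ := τ) (g := g) hh t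
  rw [max_eq_right (he.trans ht)] at this
  exact sub_nonneg.2 this

theorem measurable_ageOfInformation (hh : ∀ n, 0 ≤ h n) : Measurable (ageOfInformation e τ g h) :=
  measurable_id.sub (monotone_displayedStamp hh).measurable

/-- Monotonicity of the displayed stamp confines the age to a compact set over a bounded time
interval, where `φ` is bounded. -/
theorem intervalIntegrable_comp_age (hh : ∀ n, 0 ≤ h n) {φ : ℝ → ℝ} (hφ : Continuous φ)
    (a b : ℝ) :
    IntervalIntegrable (fun t => φ (ageOfInformation e τ g h t)) volume a b := by
  obtain ⟨C, hC⟩ := (isCompact_Icc (a := min a b - displayedStamp e τ g h (max a b))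
    (b := max a b - displayedStamp e τ g h (min a b))).exists_bound_of_continuousOn hφ.continuousOn
  rw [intervalIntegrable_iff]
  refine Measure.integrableOn_of_bounded (M := C) ?_
    (hφ.measurable.comp (measurable_ageOfInformation hh)).aestronglyMeasurable ?_
  · simp
  · refine (ae_restrict_iff' measurableSet_uIoc).2 (Eventually.of_forall fun t ht => hC _ ?_)
    rw [uIoc, mem_Ioc] at ht
    have h1 := monotone_displayedStamp (e := e) (τ := τ) (g := g) hh ht.1.le
    have h2 := monotone_displayedStamp (e := e) (τ := τ) (g := g) hh ht.2
    constructor <;> simp only [ageOfInformation] <;> linarith [ht.1, ht.2]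

/-- Between two arrivals only the packet in service can change the display: an older informative
packet completed before its successor arrived, and later packets have not arrived yet. -/
theorem displayedStamp_of_isGreatest (hg : ∀ n, 0 ≤ g n) (hh : ∀ n, 0 ≤ h n) {n : ℕ} {c t : ℝ}
    (hc : IsGreatest (insert e {y | ∃ m < n, Informative τ g h m ∧ y = arrival τ g m}) c)
    (he : e ≤ arrival τ g n) (ht : arrival τ g n ≤ t) (ht' : t < arrival τ g (n + 1)) :
    displayedStamp e τ g h t = if arrival τ g n + h n ≤ t then arrival τ g n else c := by
  refine IsGreatest.csSup_eq ⟨?_, ?_⟩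
  · split_ifs with hd
    · exact Or.inr ⟨n, hd.trans ht'.le, hd, rfl⟩
    · rcases hc.1 with h | ⟨m, hm, hi, h⟩
      · exact Or.inl h
      · exact Or.inr ⟨m, hi, (hi.trans (monotone_arrival hg hm)).trans ht, h⟩
  · have hcn : c ≤ arrival τ g n := by
      rcases hc.1 with h | ⟨m, hm, -, h⟩
      · exact h ▸ he
      · exact h ▸ monotone_arrival hg hm.le
    have hle : c ≤ if arrival τ g n + h n ≤ t then arrival τ g n else c := by
      split_ifs
      · exact hcn
      · exact le_rfl
    rintro y (rfl | ⟨m, hi, hd, rfl⟩)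
    · exact (hc.2 (mem_insert _ _)).trans hle
    · rcases lt_trichotomy m n with hmn | rfl | hmn
      · exact (hc.2 (Or.inr ⟨m, hmn, hi, rfl⟩)).trans hle
      · rw [if_pos (show arrival τ g m + h m ≤ t from hd)]
      · exfalso
        have h1 : arrival τ g (n + 1) ≤ arrival τ g m := monotone_arrival hg hmn
        rw [departure] at hd
        linarith [hh m]

/-- An informative packet at least as recent as `e` erases the initial data, and with it the
arbitrary value at which `staleness` starts. From then on the recursion is exact, whatever the
initial state was. -/
theorem isGreatest_staleness (hg : ∀ n, 0 ≤ g n) {m : ℕ} (hm : h (m + 1) ≤ g (m + 1))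
    (he : e ≤ arrival τ g (m + 1)) {n : ℕ} (hn : m + 1 ≤ n) :
    IsGreatest (insert e {y | ∃ k < n + 1, Informative τ g h k ∧ y = arrival τ g k})
      (arrival τ g (n + 1) - staleness (fun k => (g (k + 1), h (k + 1))) n) := by
  have hinf : ∀ k, h (k + 1) ≤ g (k + 1) → e ≤ arrival τ g (k + 1) →
      IsGreatest (insert e {y | ∃ i < k + 2, Informative τ g h i ∧ y = arrival τ g i})
      (arrival τ g (k + 2) - staleness (fun k => (g (k + 1), h (k + 1))) (k + 1)) := by
    intro k hk hek
    rw [staleness, if_neg (not_lt.2 hk), arrival_succ, add_zero, add_sub_cancel_right]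
    refine ⟨Or.inr ⟨k + 1, by omega, (informative_iff _).2 hk, rfl⟩, ?_⟩
    rintro y (rfl | ⟨i, hi, -, rfl⟩)
    · exact hek
    · exact monotone_arrival hg (by omega)
  induction n, hn using Nat.le_induction with
  | base => exact hinf m hm he
  | succ n hn ih =>
    by_cases hi : h (n + 1) ≤ g (n + 1)
    · exact hinf n hi (he.trans (monotone_arrival hg (by omega)))
    · have hset : {y | ∃ i < n + 1 + 1, Informative τ g h i ∧ y = arrival τ g i} =
          {y | ∃ i < n + 1, Informative τ g h i ∧ y = arrival τ g i} := by
        ext y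
        refine ⟨fun ⟨i, hlt, hinf, hy⟩ => ⟨i, ?_, hinf, hy⟩, fun ⟨i, hlt, hy⟩ => ⟨i, by omega, hy⟩⟩
        rcases Nat.lt_succ_iff_lt_or_eq.1 hlt with hlt | rfl
        · exact hlt
        · exact absurd ((informative_iff _).1 hinf) hi
      rw [hset, staleness, if_pos (not_le.1 hi), arrival_succ]
      convert ih using 1
      ring

/-- Integral of `φ` of the age over the interarrival interval `p.1` of a packet with service time
`p.2`, on whose arrival the information on display has age `c`. -/
noncomputable def cycleReward (φ : ℝ → ℝ) (c : ℝ) (p : ℝ × ℝ) : ℝ :=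
  (∫ v in (0 : ℝ)..min p.1 p.2, φ (c + v)) + ∫ v in (min p.1 p.2)..p.1, φ v

/-- Split the interval at the completion or, if that comes first, the preemption of the service;
under preemption the second piece is empty. Endpoints do not affect the integrals. -/
theorem integral_age_eq_cycleReward (hg : ∀ n, 0 ≤ g n) (hh : ∀ n, 0 ≤ h n) {φ : ℝ → ℝ}
    (hφ : Continuous φ) {n : ℕ} {c : ℝ}
    (hc : IsGreatest (insert e {y | ∃ m < n, Informative τ g h m ∧ y = arrival τ g m})
      (arrival τ g n - c)) (he : e ≤ arrival τ g n) :
    ∫ t in (arrival τ g n)..(arrival τ g (n + 1)), φ (ageOfInformation e τ g h t) =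
      cycleReward φ c (g n, h n) := by
  set T := arrival τ g n with hT
  have hS : arrival τ g (n + 1) = T + g n := arrival_succ τ g n
  have hm0 : 0 ≤ min (g n) (h n) := le_min (hg n) (hh n)
  have hmg : min (g n) (h n) ≤ g n := min_le_left _ _
  have hint := fun a b => intervalIntegrable_comp_age (e := e) (τ := τ) (g := g) hh hφ a b
  have hage : ∀ t ∈ Ico T (T + g n), ageOfInformation e τ g h t =
      t - if T + h n ≤ t then T else T - c := fun t ht => by
    rw [ageOfInformation, displayedStamp_of_isGreatest hg hh hc he ht.1 (hS ▸ ht.2)]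
  rw [hS, ← intervalIntegral.integral_add_adjacent_intervals (hint T (T + min (g n) (h n)))
    (hint _ _), cycleReward]
  congr 1
  · rw [intervalIntegral.integral_congr_Ioo_of_le (g := fun t => φ (c + (t - T))) (by linarith)]
    · rw [intervalIntegral.integral_comp_sub_right (fun v => φ (c + v))]
      simp
    · intro t ht
      have h1 : t < T + h n := ht.2.trans_le (by linarith [min_le_right (g n) (h n)])
      simp only
      rw [hage t ⟨ht.1.le, ht.2.trans_le (by linarith)⟩, if_neg (not_le.2 h1)]
      congr 1; ring
  · rw [intervalIntegral.integral_congr_Ioo_of_le (g := fun t => φ (t - T)) (by linarith)]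
    · rw [intervalIntegral.integral_comp_sub_right (fun v => φ v)]
      simp
    · intro t ht
      have h1 : T + h n ≤ t := by
        rcases min_choice (g n) (h n) with hmin | hmin
        · rw [hmin] at ht; exact absurd (ht.1.trans ht.2) (lt_irrefl _)
        · rw [hmin] at ht; exact ht.1.le
      simp only
      rw [hage t ⟨by linarith [ht.1], ht.2⟩, if_pos h1]

theorem tendsto_average_age (he : e ≤ 0) (hg : ∀ n, 0 ≤ g n) (hh : ∀ n, 0 ≤ h n) {φ : ℝ → ℝ}
    (hφ : Continuous φ) (hφ0 : ∀ x, 0 ≤ x → 0 ≤ φ x) {c L : ℝ} (hc : 0 < c)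
    (hinf : ∃ᶠ n in atTop, h (n + 1) ≤ g (n + 1))
    (hgc : Tendsto (fun N : ℕ => (∑ n ∈ Finset.range N, g (n + 1)) / N) atTop (𝓝 c))
    (hL : Tendsto (fun N : ℕ => (∑ n ∈ Finset.range N,
      cycleReward φ (staleness (fun k => (g (k + 1), h (k + 1))) n) (g (n + 1), h (n + 1))) / N)
      atTop (𝓝 L)) :
    Tendsto (fun T : ℝ => T⁻¹ * ∫ t in (0 : ℝ)..T, φ (ageOfInformation e τ g h t))
      atTop (𝓝 (L / c)) := by
  set r : ℕ → ℝ := fun n =>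
    cycleReward φ (staleness (fun k => (g (k + 1), h (k + 1))) n) (g (n + 1), h (n + 1)) with hr
  have hint := fun a b => intervalIntegrable_comp_age (e := e) (τ := τ) (g := g) hh hφ a b
  have hconst : ∀ b : ℝ, Tendsto (fun N : ℕ => b / (N : ℝ)) atTop (𝓝 0) := fun b =>
    tendsto_const_nhds.div_atTop tendsto_natCast_atTop_atTop
  have harr : ∀ n, arrival τ g (n + 1) = (τ + g 0) + ∑ i ∈ Finset.range n, g (i + 1) := fun n => by
    rw [arrival, Finset.sum_range_succ']; ring
  have hac : Tendsto (fun n : ℕ => arrival τ g (n + 1) / n) atTop (𝓝 c) := by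
    have := (hconst (τ + g 0)).add hgc
    rw [zero_add] at this
    refine this.congr fun n => ?_
    rw [harr, add_div (τ + g 0)]
  have hmono : Monotone fun n => arrival τ g (n + 1) := fun a b hab =>
    monotone_arrival hg (by omega)
  have hatop : Tendsto (fun n => arrival τ g (n + 1)) atTop atTop := by
    refine (hac.pos_mul_atTop hc tendsto_natCast_atTop_atTop).congr' ?_
    filter_upwards [eventually_gt_atTop 0] with n hn
    have : (n : ℝ) ≠ 0 := by exact_mod_cast hn.ne'
    field_simp
  -- Packet `m + 1` is informative and no older than the initial stamp, so the recursion is exact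
  -- after it.
  obtain ⟨m, hm, hem⟩ := (hinf.and_eventually (hatop.eventually_ge_atTop e)).exists
  have hnonneg : ∀ t, 0 ≤ t → 0 ≤ φ (ageOfInformation e τ g h t) := fun t ht =>
    hφ0 _ (ageOfInformation_nonneg he hh ht)
  refine tendsto_inv_mul_of_tendsto_div hmono hac hc (fun a ha b hb hab => ?_) (fun T hT => ?_) ?_
  · rw [← sub_nonneg, intervalIntegral.integral_interval_sub_left (hint _ _) (hint _ _)]
    exact intervalIntegral.integral_nonneg hab fun t ht => hnonneg t (le_trans ha ht.1)
  · exact intervalIntegral.integral_nonneg hT fun t ht => hnonneg t ht.1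
  -- The integral up to an arrival and the sum of rewards differ by a constant from here on, and
  -- this constant disappears on division by `N`.
  · have hcyc : ∀ N, m + 1 ≤ N → ∫ t in (0 : ℝ)..(arrival τ g (N + 1)),
        φ (ageOfInformation e τ g h t) = ((∫ t in (0 : ℝ)..(arrival τ g (m + 1 + 1)),
        φ (ageOfInformation e τ g h t)) - ∑ n ∈ Finset.range (m + 1), r n) +
          ∑ n ∈ Finset.range N, r n := by
      intro N hN
      induction N, hN using Nat.le_induction with
      | base => ring
      | succ N hN ih =>
        rw [Finset.sum_range_succ _ N, ← add_assoc, ← ih,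
          ← intervalIntegral.integral_add_adjacent_intervals (hint 0 (arrival τ g (N + 1)))
            (hint _ _),
          integral_age_eq_cycleReward hg hh hφ (isGreatest_staleness hg hm hem hN)
            (hem.trans (monotone_arrival hg (by omega)))]
    have := (hconst ((∫ t in (0 : ℝ)..(arrival τ g (m + 1 + 1)),
        φ (ageOfInformation e τ g h t)) - ∑ n ∈ Finset.range (m + 1), r n)).add hL
    rw [zero_add] at this
    refine this.congr' ?_
    filter_upwards [eventually_ge_atTop (m + 1)] with N hN
    rw [hcyc N hN, add_div]

end SamplePath
-- Rewards for exponential and identity test functions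
section CycleReward

/-- The result is affine in `exp (-s * c)`, so only the long-run behaviour of that single quantity
is needed. -/
theorem cycleReward_exp {s : ℝ} (hs : s ≠ 0) (c : ℝ) (p : ℝ × ℝ) :
    cycleReward (fun x => Real.exp (-s * x)) c p =
      (Real.exp (-s * c) - Real.exp (-s * c) * Real.exp (-s * min p.1 p.2) +
        (Real.exp (-s * min p.1 p.2) - Real.exp (-s * p.1))) / s := by
  have h : ∀ v, Real.exp (-s * (c + v)) = Real.exp (-s * c) * Real.exp (-s * v) := fun v => by
    rw [← Real.exp_add]; ring_nf
  rw [cycleReward, integral_exp_neg_mul hs]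
  simp_rw [h]
  rw [intervalIntegral.integral_const_mul, integral_exp_neg_mul hs]
  simp only [mul_zero, Real.exp_zero]
  ring

theorem cycleReward_id (c : ℝ) (p : ℝ × ℝ) :
    cycleReward (fun x => x) c p = c * min p.1 p.2 + p.1 ^ 2 / 2 := by
  rw [cycleReward, intervalIntegral.integral_add (by simp) (by simp), integral_id, integral_id]
  simp
  ring

end CycleReward

/-! ### Splitting expectations over the events G < H and H < G -/

section LawIdentities

variable {μG μH : Measure ℝ} [IsProbabilityMeasure μG] [IsProbabilityMeasure μH]

omit [IsProbabilityMeasure μG] [IsProbabilityMeasure μH] in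
theorem integral_eq_add_of_tie_null (htie : (μG.prod μH) {p | p.1 = p.2} = 0) {f : ℝ × ℝ → ℝ}
    (hf : Integrable f (μG.prod μH)) :
    ∫ p, f p ∂(μG.prod μH) = (∫ p in {p | p.1 < p.2}, f p ∂(μG.prod μH)) +
      ∫ p in {p | p.2 < p.1}, f p ∂(μG.prod μH) := by
  rw [← integral_add_compl measurableSet_fst_lt_snd hf]
  congr 1
  refine setIntegral_congr_set (eventuallyEq_set.2 ?_)
  have : ∀ᵐ p ∂(μG.prod μH), p.1 ≠ p.2 := by simpa [ae_iff] using htie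
  filter_upwards [this] with p hp
  simp only [mem_compl_iff, mem_ofPred_eq, not_lt]
  exact ⟨fun h => lt_of_le_of_ne h hp.symm, le_of_lt⟩

/-- Without ties, the minimum is a mixture of the two conditional laws with weights `ζ` and `1 - ζ`.
-/
theorem integral_comp_min (htie : (μG.prod μH) {p | p.1 = p.2} = 0)
    (hζ0 : 0 < preemptProb μG μH) (hζ1 : preemptProb μG μH < 1) {f : ℝ → ℝ} (hf : Measurable f)
    (hfi : Integrable (fun p : ℝ × ℝ => f (min p.1 p.2)) (μG.prod μH)) :
    ∫ p, f (min p.1 p.2) ∂(μG.prod μH) =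
      preemptProb μG μH * (∫ x, f x ∂(lawGltH μG μH)) +
        (1 - preemptProb μG μH) * ∫ x, f x ∂(lawHltG μG μH) := by
  rw [integral_eq_add_of_tie_null htie hfi, ← smul_eq_mul, ← smul_eq_mul,
    integral_lawGltH hζ0 hf.stronglyMeasurable, integral_lawHltG htie hζ1 hf.stronglyMeasurable]
  congr 1
  · refine setIntegral_congr_fun measurableSet_fst_lt_snd fun p hp => ?_
    simp only [min_eq_left (le_of_lt (show p.1 < p.2 from hp))]
  · refine setIntegral_congr_fun measurableSet_snd_lt_fst fun p hp => ?_
    simp only [min_eq_right (le_of_lt (show p.2 < p.1 from hp))]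

omit [IsProbabilityMeasure μG] [IsProbabilityMeasure μH] in
theorem integral_ite_fst_lt_snd (f : ℝ × ℝ → ℝ) :
    ∫ p, (if p.1 < p.2 then f p else 0) ∂(μG.prod μH) =
      ∫ p in {p | p.1 < p.2}, f p ∂(μG.prod μH) := by
  rw [← integral_indicator measurableSet_fst_lt_snd]
  rfl

omit [IsProbabilityMeasure μG] [IsProbabilityMeasure μH] in
theorem ae_fst_of_ae {q : ℝ → Prop} (h : ∀ᵐ x ∂μG, q x) : ∀ᵐ p ∂(μG.prod μH), q p.1 :=
  Measure.quasiMeasurePreserving_fst.ae h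

omit [IsProbabilityMeasure μG] [IsProbabilityMeasure μH] in
theorem ae_snd_of_ae {q : ℝ → Prop} (h : ∀ᵐ x ∂μH, q x) : ∀ᵐ p ∂(μG.prod μH), q p.2 :=
  Measure.quasiMeasurePreserving_snd.ae h

end LawIdentities

/-! ### Long-run averages of the rewards -/

section Averages

variable {Ω : Type*} [MeasurableSpace Ω] {P : Measure Ω} [IsProbabilityMeasure P]
  {μG μH : Measure ℝ} [IsProbabilityMeasure μG] [IsProbabilityMeasure μH]
  {X : ℕ → Ω → ℝ × ℝ}

omit [MeasurableSpace Ω] in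
theorem measurable_staleness (n : ℕ) :
    Measurable[strictPast X n] fun ω => staleness (fun k => X k ω) n := by
  induction n with
  | zero => exact measurable_const
  | succ n ih =>
    have hX : Measurable[strictPast X (n + 1)] (X n) := measurable_strictPast X (Nat.lt_succ_self n)
    have ih' : Measurable[strictPast X (n + 1)] fun ω => staleness (fun k => X k ω) n :=
      ih.mono (strictPast_mono X (Nat.le_succ n)) le_rfl
    simp only [staleness]
    refine Measurable.add (measurable_fst.comp hX) (Measurable.ite ?_ ih' measurable_const)
    exact hX measurableSet_fst_lt_snd

theorem tendsto_const_div_natCast (b : ℝ) : Tendsto (fun N : ℕ => b / (N : ℝ)) atTop (𝓝 0) :=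
  tendsto_const_nhds.div_atTop tendsto_natCast_atTop_atTop

omit [IsProbabilityMeasure P] in
-- The strong law gives informative packets the positive frequency `1 - ζ`, whereas finitely many
-- would have frequency zero.
theorem ae_frequently_informative (hX : ∀ n, Measurable (X n)) (hind : iIndepFun X P)
    (hlaw : ∀ n, P.map (X n) = μG.prod μH) (hζ1 : preemptProb μG μH < 1) :
    ∀ᵐ ω ∂P, ∃ᶠ n in atTop, (X n ω).2 ≤ (X n ω).1 := by
  have hm : MeasurableSet {p : ℝ × ℝ | p.2 ≤ p.1} := measurableSet_le measurable_snd measurable_fst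
  have hpos : 0 < ∫ p, indicator {p : ℝ × ℝ | p.2 ≤ p.1} (fun _ => (1 : ℝ)) p ∂(μG.prod μH) := by
    rw [integral_indicator hm]
    simp only [integral_const, smul_eq_mul, mul_one, measureReal_restrict_apply_univ]
    have : ({p : ℝ × ℝ | p.2 ≤ p.1} : Set (ℝ × ℝ)) = {p | p.1 < p.2}ᶜ := by
      ext p; simp
    rw [this, probReal_compl_eq_one_sub measurableSet_fst_lt_snd]
    exact sub_pos.2 hζ1
  have hslln := strong_law_comp (P := P) hX hind hlaw
    (f := indicator {p : ℝ × ℝ | p.2 ≤ p.1} (fun _ => (1 : ℝ)))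
    (measurable_const.indicator hm) ((integrable_const 1).indicator hm)
  filter_upwards [hslln] with ω hω hcon
  obtain ⟨m, hcon⟩ := eventually_atTop.1 hcon
  have h0 : Tendsto (fun N : ℕ => (∑ i ∈ Finset.range N,
      indicator {p : ℝ × ℝ | p.2 ≤ p.1} (fun _ => (1 : ℝ)) (X i ω)) / N) atTop (𝓝 0) := by
    refine (tendsto_const_div_natCast (∑ i ∈ Finset.range m,
      indicator {p : ℝ × ℝ | p.2 ≤ p.1} (fun _ => (1 : ℝ)) (X i ω))).congr' ?_
    filter_upwards [eventually_ge_atTop m] with N hN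
    have hz : ∑ i ∈ Finset.Ico m N,
        indicator {p : ℝ × ℝ | p.2 ≤ p.1} (fun _ => (1 : ℝ)) (X i ω) = 0 :=
      Finset.sum_eq_zero fun i hi => indicator_of_notMem
        (s := {p : ℝ × ℝ | p.2 ≤ p.1}) (hcon i (Finset.mem_Ico.1 hi).1) _
    rw [← Finset.sum_range_add_sum_Ico _ hN, hz, add_zero]
  exact hpos.ne' (tendsto_nhds_unique hω h0)

theorem ae_tendsto_average_reward_exp (hX : ∀ n, Measurable (X n)) (hind : iIndepFun X P)
    (hlaw : ∀ n, P.map (X n) = μG.prod μH) (hX1 : ∀ n ω, 0 ≤ (X n ω).1)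
    (hG0 : ∀ᵐ x ∂μG, 0 ≤ x) (hH0 : ∀ᵐ x ∂μH, 0 ≤ x)
    (htie : (μG.prod μH) {p | p.1 = p.2} = 0)
    (hζ0 : 0 < preemptProb μG μH) (hζ1 : preemptProb μG μH < 1) (hEG : 0 < ∫ x, x ∂μG)
    {s : ℝ} (hs : 0 < s) :
    ∀ᵐ ω ∂P, Tendsto (fun N : ℕ => (∑ n ∈ Finset.range N,
      cycleReward (fun x => Real.exp (-s * x)) (staleness (fun k => X k ω) n) (X n ω)) / N) atTop
      (𝓝 (lst (lawHltG μG μH) s * lst (residualLaw μG) s *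
        ((1 - preemptProb μG μH) / (1 - preemptProb μG μH * lst (lawGltH μG μH) s)) *
          ∫ x, x ∂μG)) := by
  have := isProbabilityMeasure_lawGltH hζ0
  have hG0' := ae_fst_of_ae (μH := μH) hG0
  have hH0' := ae_snd_of_ae (μG := μG) hH0
  have hexp : ∀ x : ℝ, 0 ≤ x → ‖Real.exp (-s * x)‖ ≤ 1 := fun x hx => by
    rw [Real.norm_eq_abs, Real.abs_exp, Real.exp_le_one_iff]; nlinarith
  set φ₁ : ℝ × ℝ → ℝ := fun p => if p.1 < p.2 then 0 else Real.exp (-s * p.1) with hφ₁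
  set φ₂ : ℝ × ℝ → ℝ := fun p => if p.1 < p.2 then Real.exp (-s * p.1) else 0 with hφ₂
  set ψ : ℝ × ℝ → ℝ := fun p => Real.exp (-s * min p.1 p.2) with hψ
  set γ : ℝ × ℝ → ℝ := fun p => Real.exp (-s * p.1) with hγ
  have mφ₁ : Measurable φ₁ := Measurable.ite measurableSet_fst_lt_snd (by fun_prop) (by fun_prop)
  have mφ₂ : Measurable φ₂ := Measurable.ite measurableSet_fst_lt_snd (by fun_prop) (by fun_prop)
  have mψ : Measurable ψ := by fun_prop
  have mγ : Measurable γ := by fun_prop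
  have bφ₁ : ∀ᵐ p ∂(μG.prod μH), ‖φ₁ p‖ ≤ 1 := hG0'.mono fun p hp => by
    simp only [hφ₁]; split_ifs
    · simp
    · exact hexp _ hp
  have bφ₂ : ∀ᵐ p ∂(μG.prod μH), ‖φ₂ p‖ ≤ 1 := hG0'.mono fun p hp => by
    simp only [hφ₂]; split_ifs
    · exact hexp _ hp
    · simp
  have bψ : ∀ᵐ p ∂(μG.prod μH), ‖ψ p‖ ≤ 1 := by
    filter_upwards [hG0', hH0'] with p h1 h2 using hexp _ (le_min h1 h2)
  have bγ : ∀ᵐ p ∂(μG.prod μH), ‖γ p‖ ≤ 1 := hG0'.mono fun p hp => hexp _ hp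
  have iφ₁ : Integrable φ₁ (μG.prod μH) := Integrable.of_bound mφ₁.aestronglyMeasurable 1 bφ₁
  have iφ₂ : Integrable φ₂ (μG.prod μH) := Integrable.of_bound mφ₂.aestronglyMeasurable 1 bφ₂
  have iψ : Integrable ψ (μG.prod μH) := Integrable.of_bound mψ.aestronglyMeasurable 1 bψ
  have iγ : Integrable γ (μG.prod μH) := Integrable.of_bound mγ.aestronglyMeasurable 1 bγ
  set Y : ℕ → Ω → ℝ := fun n ω => Real.exp (-s * staleness (fun k => X k ω) n) with hY
  have mY : ∀ n, Measurable[strictPast X n] (Y n) := fun n =>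
    Real.measurable_exp.comp ((measurable_staleness n).const_mul (-s))
  have mY' : ∀ n, Measurable (Y n) := fun n => (mY n).mono (strictPast_le hX n) le_rfl
  have bY : ∀ n ω, ‖Y n ω‖ ≤ 1 := fun n ω => hexp _ (staleness_nonneg (fun k => hX1 k ω) n)
  have Y2 : ∀ n, MemLp (Y n) 2 P := fun n =>
    MemLp.of_bound (mY' n).aestronglyMeasurable 1 (Eventually.of_forall (bY n))
  have YM : ∀ n, ∫ ω, Y n ω ^ 2 ∂P ≤ 1 := fun n => by
    calc ∫ ω, Y n ω ^ 2 ∂P ≤ ∫ _, (1 : ℝ) ∂P := by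
          refine integral_mono (Y2 n).integrable_sq (integrable_const 1) fun ω => ?_
          rw [← sq_abs]
          exact pow_le_one₀ (abs_nonneg _) (bY n ω)
      _ = 1 := by simp
  -- The affine recursion of `Y`: an informative packet resets it (`φ₁`), a preempted one multiplies
  -- it (`φ₂`).
  have hrec : ∀ n ω, Y (n + 1) ω = φ₁ (X n ω) + φ₂ (X n ω) * Y n ω := fun n ω => by
    simp only [hY, hφ₁, hφ₂, staleness]
    split_ifs
    · rw [← Real.exp_add]; ring_nf
    · simp
  have hb : ∫ p, φ₂ p ∂(μG.prod μH) = preemptProb μG μH * lst (lawGltH μG μH) s := by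
    rw [hφ₂, integral_ite_fst_lt_snd, lst, ← smul_eq_mul, integral_lawGltH hζ0]
    exact Measurable.stronglyMeasurable (by fun_prop)
  have hm : ∫ p, ψ p ∂(μG.prod μH) = preemptProb μG μH * lst (lawGltH μG μH) s +
      (1 - preemptProb μG μH) * lst (lawHltG μG μH) s :=
    integral_comp_min htie hζ0 hζ1 (f := fun x => Real.exp (-s * x)) (by fun_prop) iψ
  have hγG : ∫ p, γ p ∂(μG.prod μH) = lst μG s := by
    rw [hγ, integral_fun_fst (fun x => Real.exp (-s * x))]; simp [lst]
  have ha : ∫ p, φ₁ p ∂(μG.prod μH) = lst μG s - preemptProb μG μH * lst (lawGltH μG μH) s := by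
    rw [← hb, ← hγG, ← integral_sub iγ iφ₂]
    refine integral_congr_ae (Eventually.of_forall fun p => ?_)
    simp only [hφ₁, hφ₂, hγ]
    split_ifs <;> simp
  have hlt : lst (lawGltH μG μH) s ≤ 1 := by
    have := norm_integral_le_of_norm_le_const (μ := lawGltH μG μH)
      (f := fun x => Real.exp (-s * x)) (C := 1)
      ((ae_lawGltH (q := fun x => 0 ≤ x) measurableSet_Ici hG0').mono fun x hx => hexp x hx)
    simp only [probReal_univ, mul_one] at this
    exact (le_abs_self _).trans this
  have hden : 0 < 1 - preemptProb μG μH * lst (lawGltH μG μH) s := by nlinarith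
  have L2 : ∀ {f : ℝ × ℝ → ℝ}, Measurable f → (∀ᵐ p ∂(μG.prod μH), ‖f p‖ ≤ 1) →
      MemLp f 2 (μG.prod μH) := fun hf h => MemLp.of_bound hf.aestronglyMeasurable 1 h
  filter_upwards [strong_law_comp hX hind hlaw mφ₁ iφ₁, strong_law_comp hX hind hlaw mψ iψ,
    strong_law_comp hX hind hlaw mγ iγ,
    strong_law_predictable hX hind hlaw mY Y2 YM mφ₂ (L2 mφ₂ bφ₂),
    strong_law_predictable hX hind hlaw mY Y2 YM mψ (L2 mψ bψ)] with ω h1 h2 h3 h4 h5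
  rw [hb] at h4
  set b := preemptProb μG μH * lst (lawGltH μG μH) s with hbdef
  have hbdd : Tendsto (fun N : ℕ => (Y N ω - Y 0 ω) / N) atTop (𝓝 0) := by
    refine squeeze_zero_norm (fun N => ?_) (tendsto_const_div_natCast 2)
    rw [norm_div, Real.norm_natCast]
    gcongr
    exact (norm_sub_le _ _).trans (by linarith [bY N ω, bY 0 ω])
  -- The summed recursion, with `φ₂` split into its mean `b` and a centred part. The centred sum is
  -- a martingale transform and the last term is bounded, so both vanish on average.
  have hsum : ∀ N : ℕ, (1 - b) * ∑ n ∈ Finset.range N, Y n ω =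
      (∑ n ∈ Finset.range N, φ₁ (X n ω)) + (∑ n ∈ Finset.range N, Y n ω * (φ₂ (X n ω) - b)) -
        (Y N ω - Y 0 ω) := fun N => by
    induction N with
    | zero => simp
    | succ N ih =>
      simp only [Finset.sum_range_succ]
      rw [mul_add, ih, hrec]
      ring
  have hYlim : Tendsto (fun N : ℕ => (∑ n ∈ Finset.range N, Y n ω) / N) atTop
      (𝓝 ((lst μG s - b) / (1 - b))) := by
    have h := ((h1.add h4).sub hbdd).div_const (1 - b)
    rw [ha, add_zero, sub_zero] at h
    refine h.congr fun N => ?_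
    rw [← add_div, ← sub_div, ← hsum, mul_div_assoc, mul_div_cancel_left₀ _ hden.ne']
  have hYψ : Tendsto (fun N : ℕ => (∑ n ∈ Finset.range N, Y n ω * ψ (X n ω)) / N) atTop
      (𝓝 ((∫ p, ψ p ∂(μG.prod μH)) * ((lst μG s - b) / (1 - b)))) := by
    have h := h5.add (hYlim.const_mul (∫ p, ψ p ∂(μG.prod μH)))
    rw [zero_add] at h
    refine h.congr fun N => ?_
    rw [← mul_div_assoc, ← add_div, Finset.mul_sum, ← Finset.sum_add_distrib]
    congr 1
    exact Finset.sum_congr rfl fun n _ => by ring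
  have hfin := (((hYlim.sub hYψ).add (h2.sub h3))).div_const s
  rw [hγG, hm] at hfin
  -- With `m` the transform of the minimum and `g` that of `μG`, this is `(1 - m) * (g - b) / (1 -
  -- b) + m - g = (m - b) * (1 - g) / (1 - b)`, where `m - b = (1 - ζ) * lst (lawHltG μG μH) s`.
  have hval : lst (lawHltG μG μH) s * lst (residualLaw μG) s *
        ((1 - preemptProb μG μH) / (1 - b)) * (∫ x, x ∂μG) =
      ((lst μG s - b) / (1 - b) - (b + (1 - preemptProb μG μH) * lst (lawHltG μG μH) s) *
        ((lst μG s - b) / (1 - b)) + (b + (1 - preemptProb μG μH) * lst (lawHltG μG μH) s -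
          lst μG s)) / s := by
    rw [lst_residualLaw hG0 hEG hs]
    have := hden.ne'
    field_simp
    ring
  rw [hval]
  refine hfin.congr fun N => ?_
  rw [← sub_div, ← sub_div, ← add_div, div_right_comm]
  congr 1
  rw [← Finset.sum_sub_distrib, ← Finset.sum_sub_distrib, ← Finset.sum_add_distrib, Finset.sum_div]
  exact Finset.sum_congr rfl fun n _ => (cycleReward_exp hs.ne' _ _).symm

/-- The old staleness survives only on preemption, an event of probability `ζ < 1` independent of
it, so the second moments satisfy a contracting recursion. -/
theorem exists_bound_staleness_sq (hX : ∀ n, Measurable (X n)) (hind : iIndepFun X P)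
    (hlaw : ∀ n, P.map (X n) = μG.prod μH)
    (hζ0 : 0 < preemptProb μG μH) (hζ1 : preemptProb μG μH < 1)
    (h2 : Integrable (fun x : ℝ => x ^ 2) μG) :
    ∃ K : ℝ, ∀ n, MemLp (fun ω => staleness (fun k => X k ω) n) 2 P ∧
      ∫ ω, staleness (fun k => X k ω) n ^ 2 ∂P ≤ K := by
  set ζ := preemptProb μG μH with hζ
  -- The weight in `(a + b) ^ 2 ≤ (1 + 1 / δ) * a ^ 2 + (1 + δ) * b ^ 2`, chosen so that `(1 + δ) *
  -- ζ` is the midpoint of `ζ` and `1`.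
  set δ := (1 - ζ) / (2 * ζ) with hδ
  have hδ0 : 0 < δ := by have := sub_pos.2 hζ1; positivity
  set V := ∫ x, x ^ 2 ∂μG with hV
  have hV0 : 0 ≤ V := integral_nonneg fun _ => sq_nonneg _
  have hr : (1 + δ) * ζ = (1 + ζ) / 2 := by rw [hδ]; field_simp; ring
  have hMC : ∀ n, Measurable fun ω => staleness (fun k => X k ω) n := fun n =>
    (measurable_staleness n).mono (strictPast_le hX n) le_rfl
  have hG2 : ∀ n, Integrable (fun ω => (X n ω).1 ^ 2) P := fun n => by
    have : Integrable (fun p : ℝ × ℝ => p.1 ^ 2) (P.map (X n)) := by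
      rw [hlaw n]; exact h2.comp_fst μH
    exact this.comp_measurable (hX n)
  have hG2v : ∀ n, ∫ ω, (X n ω).1 ^ 2 ∂P = V := fun n => by
    rw [← integral_map (f := fun p : ℝ × ℝ => p.1 ^ 2) (hX n).aemeasurable (by fun_prop), hlaw n,
      integral_fun_fst (fun x : ℝ => x ^ 2)]
    simp [hV]
  set u : ℝ × ℝ → ℝ := fun p => if p.1 < p.2 then 1 else 0 with hu
  have mu : Measurable u := Measurable.ite measurableSet_fst_lt_snd (by fun_prop) (by fun_prop)
  have bu : ∀ p, ‖u p‖ ≤ 1 := fun p => by simp only [hu]; split_ifs <;> simp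
  have iu : ∀ n, Integrable (fun ω => u (X n ω)) P := fun n =>
    Integrable.of_bound (mu.comp (hX n)).aestronglyMeasurable 1 (Eventually.of_forall fun _ => bu _)
  have vu : ∀ n, ∫ ω, u (X n ω) ∂P = ζ := fun n => by
    rw [← integral_map (hX n).aemeasurable mu.aestronglyMeasurable, hlaw n, hu,
      integral_ite_fst_lt_snd]
    simp [hζ, preemptProb]
  -- The bound is the fixed point of `x ↦ (1 + 1 / δ) * V + (1 + ζ) / 2 * x`.
  refine ⟨(1 + 1 / δ) * V / (1 - (1 + ζ) / 2), fun n => ?_⟩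
  have hden : 0 < 1 - (1 + ζ) / 2 := by linarith
  induction n with
  | zero =>
    refine ⟨by simp [staleness], ?_⟩
    simp only [staleness]
    simp only [ne_eq, OfNat.ofNat_ne_zero, not_false_eq_true, zero_pow, integral_zero]
    positivity
  | succ n ih =>
    obtain ⟨ihL, ihK⟩ := ih
    have hind' : IndepFun (fun ω => u (X n ω)) (fun ω => staleness (fun k => X k ω) n ^ 2) P :=
      ((indepFun_of_strictPast hX hind (measurable_staleness n)).comp
        (measurable_id.pow_const 2) mu).symm
    have iuC : Integrable (fun ω => u (X n ω) * staleness (fun k => X k ω) n ^ 2) P :=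
      hind'.integrable_mul (iu n) ihL.integrable_sq
    have vuC : ∫ ω, u (X n ω) * staleness (fun k => X k ω) n ^ 2 ∂P =
        ζ * ∫ ω, staleness (fun k => X k ω) n ^ 2 ∂P := by
      rw [hind'.integral_fun_mul_eq_mul_integral (iu n).aestronglyMeasurable
        ihL.integrable_sq.aestronglyMeasurable, vu]
    have hle : ∀ ω, staleness (fun k => X k ω) (n + 1) ^ 2 ≤ (1 + 1 / δ) * (X n ω).1 ^ 2 +
        (1 + δ) * (u (X n ω) * staleness (fun k => X k ω) n ^ 2) := fun ω => by
      have key : ∀ a b : ℝ, (a + b) ^ 2 ≤ (1 + 1 / δ) * a ^ 2 + (1 + δ) * b ^ 2 := fun a b => by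
        have : (1 + 1 / δ) * a ^ 2 + (1 + δ) * b ^ 2 - (a + b) ^ 2 = (a - δ * b) ^ 2 / δ := by
          field_simp; ring
        have h3 : 0 ≤ (a - δ * b) ^ 2 / δ := by positivity
        linarith
      rw [staleness]
      simp only [hu]
      split_ifs
      · rw [one_mul]; exact key _ _
      · have := key (X n ω).1 0
        simpa using this
    have irhs : Integrable (fun ω => (1 + 1 / δ) * (X n ω).1 ^ 2 +
        (1 + δ) * (u (X n ω) * staleness (fun k => X k ω) n ^ 2)) P :=
      ((hG2 n).const_mul _).add (iuC.const_mul _)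
    have iC : Integrable (fun ω => staleness (fun k => X k ω) (n + 1) ^ 2) P :=
      irhs.mono' ((hMC (n + 1)).pow_const 2).aestronglyMeasurable
        (Eventually.of_forall fun ω => by
          rw [Real.norm_of_nonneg (sq_nonneg _)]; exact hle ω)
    refine ⟨(memLp_two_iff_integrable_sq (hMC (n + 1)).aestronglyMeasurable).2 iC, ?_⟩
    calc ∫ ω, staleness (fun k => X k ω) (n + 1) ^ 2 ∂P
        ≤ (1 + 1 / δ) * V + (1 + δ) * (ζ * ∫ ω, staleness (fun k => X k ω) n ^ 2 ∂P) := by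
          refine (integral_mono iC irhs hle).trans_eq ?_
          rw [integral_add ((hG2 n).const_mul _) (iuC.const_mul _), integral_const_mul,
            integral_const_mul, hG2v, vuC]
      _ ≤ (1 + 1 / δ) * V + (1 + ζ) / 2 * ((1 + 1 / δ) * V / (1 - (1 + ζ) / 2)) := by
          rw [← mul_assoc, hr]
          gcongr
      _ = (1 + 1 / δ) * V / (1 - (1 + ζ) / 2) := by
          generalize (1 + 1 / δ) * V = B
          generalize (1 + ζ) / 2 = r at hden
          have := hden.ne'
          field_simp
          ring

/-- The average staleness solves `c = E[G] + ζ * c`. Since staleness is independent of the current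
packet, its product with `min G H` averages to the product of the averages. -/
theorem ae_tendsto_average_reward_id (hX : ∀ n, Measurable (X n)) (hind : iIndepFun X P)
    (hlaw : ∀ n, P.map (X n) = μG.prod μH)
    (hG0 : ∀ᵐ x ∂μG, 0 ≤ x) (hH0 : ∀ᵐ x ∂μH, 0 ≤ x)
    (htie : (μG.prod μH) {p | p.1 = p.2} = 0)
    (hζ0 : 0 < preemptProb μG μH) (hζ1 : preemptProb μG μH < 1)
    (hG : Integrable (fun x : ℝ => x) μG) (hEG : 0 < ∫ x, x ∂μG)
    (h2 : Integrable (fun x : ℝ => x ^ 2) μG) :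
    ∀ᵐ ω ∂P, Tendsto (fun N : ℕ => (∑ n ∈ Finset.range N,
      cycleReward (fun x => x) (staleness (fun k => X k ω) n) (X n ω)) / N) atTop
      (𝓝 (((∫ x, x ∂(lawHltG μG μH)) + (∫ x, x ^ 2 ∂μG) / (2 * (∫ x, x ∂μG)) +
          preemptProb μG μH / (1 - preemptProb μG μH) * (∫ x, x ∂(lawGltH μG μH))) *
          ∫ x, x ∂μG)) := by
  have hG0' := ae_fst_of_ae (μH := μH) hG0
  have hH0' := ae_snd_of_ae (μG := μG) hH0
  obtain ⟨K, hK⟩ := exists_bound_staleness_sq hX hind hlaw hζ0 hζ1 h2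
  set ζ := preemptProb μG μH with hζ
  set C : ℕ → Ω → ℝ := fun n ω => staleness (fun k => X k ω) n with hC
  set v : ℝ × ℝ → ℝ := fun p => if p.1 < p.2 then 1 else 0 with hv
  have mv : Measurable v := Measurable.ite measurableSet_fst_lt_snd (by fun_prop) (by fun_prop)
  have bv : ∀ p, ‖v p‖ ≤ 1 := fun p => by simp only [hv]; split_ifs <;> simp
  have v2 : MemLp v 2 (μG.prod μH) :=
    MemLp.of_bound mv.aestronglyMeasurable 1 (Eventually.of_forall bv)
  have vint : ∫ p, v p ∂(μG.prod μH) = ζ := by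
    rw [hv, integral_ite_fst_lt_snd]; simp [hζ, preemptProb]
  set ψ : ℝ × ℝ → ℝ := fun p => min p.1 p.2 with hψ
  have mψ : Measurable ψ := by fun_prop
  have bψ : ∀ᵐ p ∂(μG.prod μH), ‖ψ p‖ ≤ ‖p.1‖ := by
    filter_upwards [hG0', hH0'] with p h1 h2
    rw [Real.norm_of_nonneg h1, Real.norm_of_nonneg (le_min h1 h2)]
    exact min_le_left _ _
  have fst2 : MemLp (fun p : ℝ × ℝ => p.1) 2 (μG.prod μH) :=
    (memLp_two_iff_integrable_sq (by fun_prop)).2 (h2.comp_fst μH)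
  have ψ2 : MemLp ψ 2 (μG.prod μH) := fst2.mono mψ.aestronglyMeasurable bψ
  have ψint : ∫ p, ψ p ∂(μG.prod μH) =
      ζ * (∫ x, x ∂(lawGltH μG μH)) + (1 - ζ) * ∫ x, x ∂(lawHltG μG μH) :=
    integral_comp_min htie hζ0 hζ1 (f := fun x => x) measurable_id (ψ2.integrable (by norm_num))
  have gint : ∫ p : ℝ × ℝ, p.1 ∂(μG.prod μH) = ∫ x, x ∂μG := by
    rw [integral_fun_fst (fun x : ℝ => x)]; simp
  have gsqint : ∫ p : ℝ × ℝ, p.1 ^ 2 ∂(μG.prod μH) = ∫ x, x ^ 2 ∂μG := by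
    rw [integral_fun_fst (fun x : ℝ => x ^ 2)]; simp
  -- The boundary term of the summed recursion is unbounded here; the uniform second-moment bound
  -- makes `K / N ^ 2` a summable majorant.
  have hCN : ∀ᵐ ω ∂P, Tendsto (fun N : ℕ => C N ω / N) atTop (𝓝 0) := by
    refine ae_tendsto_zero_of_summable_integral_sq (c := fun N : ℕ => K / (N : ℝ) ^ 2)
      (fun N => by simpa only [div_eq_inv_mul] using (hK N).1.const_mul ((N : ℝ)⁻¹))
      (fun N => ?_) ?_
    · simp_rw [div_pow]
      rw [integral_div]
      exact div_le_div_of_nonneg_right (hK N).2 (sq_nonneg _)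
    · simp_rw [div_eq_mul_inv]
      exact (Real.summable_nat_pow_inv.2 one_lt_two).mul_left K
  filter_upwards [hCN, strong_law_comp hX hind hlaw measurable_fst (hG.comp_fst μH),
    strong_law_comp hX hind hlaw (measurable_fst.pow_const 2) (h2.comp_fst μH),
    strong_law_predictable hX hind hlaw measurable_staleness (fun n => (hK n).1)
      (fun n => (hK n).2) mv v2,
    strong_law_predictable hX hind hlaw measurable_staleness (fun n => (hK n).1)
      (fun n => (hK n).2) mψ ψ2] with ω h1 h2 h3 h4 h5
  rw [vint] at h4
  rw [gint] at h2
  rw [gsqint] at h3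
  have hsum : ∀ N : ℕ, (1 - ζ) * ∑ n ∈ Finset.range N, C n ω =
      (∑ n ∈ Finset.range N, (X n ω).1) + (∑ n ∈ Finset.range N, C n ω * (v (X n ω) - ζ)) -
        C N ω := fun N => by
    induction N with
    | zero => simp [hC, staleness]
    | succ N ih =>
      have hrec : C (N + 1) ω = (X N ω).1 + v (X N ω) * C N ω := by
        simp only [hC, hv, staleness]
        split_ifs <;> simp
      simp only [Finset.sum_range_succ]
      rw [mul_add, ih, hrec]
      ring
  have h1ζ : 1 - ζ ≠ 0 := (sub_pos.2 hζ1).ne'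
  have hClim : Tendsto (fun N : ℕ => (∑ n ∈ Finset.range N, C n ω) / N) atTop
      (𝓝 ((∫ x, x ∂μG) / (1 - ζ))) := by
    have h := ((h2.add h4).sub h1).div_const (1 - ζ)
    rw [add_zero, sub_zero] at h
    refine h.congr fun N => ?_
    rw [← add_div, ← sub_div, ← hsum, mul_div_assoc, mul_div_cancel_left₀ _ h1ζ]
  have hCψ : Tendsto (fun N : ℕ => (∑ n ∈ Finset.range N, C n ω * ψ (X n ω)) / N) atTop
      (𝓝 ((∫ p, ψ p ∂(μG.prod μH)) * ((∫ x, x ∂μG) / (1 - ζ)))) := by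
    have h := h5.add (hClim.const_mul (∫ p, ψ p ∂(μG.prod μH)))
    rw [zero_add] at h
    refine h.congr fun N => ?_
    rw [← mul_div_assoc, ← add_div, Finset.mul_sum, ← Finset.sum_add_distrib]
    congr 1
    exact Finset.sum_congr rfl fun n _ => by ring
  have hfin := hCψ.add (h3.div_const 2)
  rw [ψint] at hfin
  have hval : ((∫ x, x ∂(lawHltG μG μH)) + (∫ x, x ^ 2 ∂μG) / (2 * (∫ x, x ∂μG)) +
          ζ / (1 - ζ) * (∫ x, x ∂(lawGltH μG μH))) * (∫ x, x ∂μG) =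
      (ζ * (∫ x, x ∂(lawGltH μG μH)) + (1 - ζ) * ∫ x, x ∂(lawHltG μG μH)) *
        ((∫ x, x ∂μG) / (1 - ζ)) + (∫ x, x ^ 2 ∂μG) / 2 := by
    have := hEG.ne'
    field_simp
    ring
  rw [hval]
  refine hfin.congr fun N => ?_
  rw [div_right_comm, ← add_div, Finset.sum_div, ← Finset.sum_add_distrib]
  congr 1
  exact Finset.sum_congr rfl fun n _ => (cycleReward_id _ _).symm

end Averages
-- From transforms to distribution functions
section Moments

/-- On `[0, 1]` polynomials are uniformly dense in the continuous functions, so convergence of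
moments is weak convergence; the portmanteau theorem applies to `Ici a` because its frontier is
null. -/
theorem tendsto_real_Ici_of_tendsto_moments {ι : Type*} {l : Filter ι} {m : ι → Measure ℝ}
    [∀ i, IsProbabilityMeasure (m i)] {ν : Measure ℝ} [IsProbabilityMeasure ν]
    (hm : ∀ i, ∀ᵐ x ∂(m i), x ∈ Icc (0 : ℝ) 1) (hν : ∀ᵐ x ∂ν, x ∈ Icc (0 : ℝ) 1)
    (hmom : ∀ k : ℕ, Tendsto (fun i => ∫ x, x ^ k ∂(m i)) l (𝓝 (∫ x, x ^ k ∂ν)))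
    {a : ℝ} (ha : ν {a} = 0) :
    Tendsto (fun i => (m i).real (Ici a)) l (𝓝 (ν.real (Ici a))) := by
  have hpow : ∀ (ρ : Measure ℝ) [IsProbabilityMeasure ρ], (∀ᵐ x ∂ρ, x ∈ Icc (0 : ℝ) 1) →
      ∀ k : ℕ, Integrable (fun x => x ^ k) ρ := fun ρ _ h k =>
    Integrable.of_bound (by fun_prop) 1 (h.mono fun x hx => by
      rw [norm_pow, Real.norm_of_nonneg hx.1]; exact pow_le_one₀ hx.1 hx.2)
  have hpint : ∀ (ρ : Measure ℝ) [IsProbabilityMeasure ρ], (∀ᵐ x ∂ρ, x ∈ Icc (0 : ℝ) 1) →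
      ∀ p : Polynomial ℝ, ∫ x, p.eval x ∂ρ =
        ∑ k ∈ Finset.range (p.natDegree + 1), p.coeff k * ∫ x, x ^ k ∂ρ := fun ρ _ h p => by
    simp_rw [Polynomial.eval_eq_sum_range]
    rw [integral_finsetSum _ fun k _ => (hpow ρ h k).const_mul _]
    simp_rw [integral_const_mul]
  have hpoly : ∀ p : Polynomial ℝ,
      Tendsto (fun i => ∫ x, p.eval x ∂(m i)) l (𝓝 (∫ x, p.eval x ∂ν)) := fun p => by
    rw [hpint ν hν]
    simp_rw [fun i => hpint (m i) (hm i) p]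
    exact tendsto_finsetSum _ fun k _ => (hmom k).const_mul _
  have hpi : ∀ (ρ : Measure ℝ) [IsProbabilityMeasure ρ], (∀ᵐ x ∂ρ, x ∈ Icc (0 : ℝ) 1) →
      ∀ p : Polynomial ℝ, Integrable (fun x => p.eval x) ρ := fun ρ _ h p => by
    simp_rw [Polynomial.eval_eq_sum_range]
    exact integrable_finsetSum _ fun k _ => (hpow ρ h k).const_mul _
  let m' : ι → ProbabilityMeasure ℝ := fun i => ⟨m i, inferInstance⟩
  let ν' : ProbabilityMeasure ℝ := ⟨ν, inferInstance⟩
  have hlim : Tendsto m' l (𝓝 ν') := by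
    rw [ProbabilityMeasure.tendsto_iff_forall_integral_tendsto]
    intro f
    change Tendsto (fun i => ∫ x, f x ∂(m i)) l (𝓝 (∫ x, f x ∂ν))
    rw [Metric.tendsto_nhds]
    intro ε hε
    obtain ⟨p, hp⟩ := exists_polynomial_near_of_continuousOn 0 1 f f.continuous.continuousOn
      (ε / 3) (by linarith)
    have hclose : ∀ (ρ : Measure ℝ) [IsProbabilityMeasure ρ], (∀ᵐ x ∂ρ, x ∈ Icc (0 : ℝ) 1) →
        |∫ x, f x ∂ρ - ∫ x, p.eval x ∂ρ| ≤ ε / 3 := fun ρ _ h => by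
      rw [← integral_sub (f.integrable ρ) (hpi ρ h p)]
      have := norm_integral_le_of_norm_le_const (μ := ρ) (f := fun x => f x - p.eval x)
        (C := ε / 3) (h.mono fun x hx => by
          rw [Real.norm_eq_abs, abs_sub_comm]; exact (hp x hx).le)
      simpa using this
    filter_upwards [Metric.tendsto_nhds.1 (hpoly p) (ε / 3) (by linarith)] with i hi
    rw [Real.dist_eq] at hi ⊢
    have h1 := abs_le.1 (hclose (m i) (hm i))
    have h2 := abs_le.1 (hclose ν hν)
    have h3 := abs_lt.1 hi
    rw [abs_lt]
    constructor <;> linarith [h1.1, h1.2, h2.1, h2.2, h3.1, h3.2]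
  have h := ProbabilityMeasure.tendsto_measure_of_null_frontier_of_tendsto' hlim (E := Ici a)
    (by rw [frontier_Ici]; exact ha)
  exact (ENNReal.tendsto_toReal (measure_ne_top ν _)).comp h

/-- The map `exp (-x)` sends the occupation measure of `B` into `[0, 1]`, turns its transform at `k`
into the `k`-th moment, and turns `Iic x` into `Ici (exp (-x))`. -/
theorem tendsto_average_indicator_of_tendsto_average_exp {B : ℝ → ℝ} (hB : Measurable B)
    (hB0 : ∀ t, 0 ≤ t → 0 ≤ B t) {ν : Measure ℝ} [IsProbabilityMeasure ν]
    (hν0 : ∀ᵐ x ∂ν, 0 ≤ x) (hνa : ∀ x, ν {x} = 0)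
    (hlim : ∀ k : ℕ, Tendsto (fun T : ℝ => T⁻¹ * ∫ t in (0 : ℝ)..T, Real.exp (-k * B t)) atTop
      (𝓝 (∫ x, Real.exp (-k * x) ∂ν))) (x : ℝ) :
    Tendsto (fun T : ℝ => T⁻¹ * ∫ t in (0 : ℝ)..T, indicator {t | B t ≤ x} (fun _ => (1 : ℝ)) t)
      atTop (𝓝 (ν.real (Iic x))) := by
  have hmax : ∀ T : ℝ, 0 < max T 1 := fun T => lt_max_of_lt_right one_pos
  have hE : Measurable fun t => Real.exp (-B t) := by fun_prop
  have hexp : Measurable fun x : ℝ => Real.exp (-x) := by fun_prop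
  -- Normalised time; `max T 1` makes this a probability measure for every real `T` and equals `T`
  -- eventually.
  set u : ℝ → Measure ℝ := fun T =>
    ENNReal.ofReal (max T 1)⁻¹ • volume.restrict (Ioc 0 (max T 1)) with hu
  set m : ℝ → Measure ℝ := fun T => (u T).map fun t => Real.exp (-B t) with hm
  have hup : ∀ T, IsProbabilityMeasure (u T) := fun T => ⟨by
    simp only [hu, Measure.smul_apply, Measure.restrict_apply_univ, Real.volume_Ioc, sub_zero,
      smul_eq_mul]
    rw [← ENNReal.ofReal_mul (inv_nonneg.2 (hmax T).le), inv_mul_cancel₀ (hmax T).ne',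
      ENNReal.ofReal_one]⟩
  have hmp : ∀ T, IsProbabilityMeasure (m T) := fun T =>
    Measure.isProbabilityMeasure_map hE.aemeasurable
  have hνp : IsProbabilityMeasure (ν.map fun x => Real.exp (-x)) :=
    Measure.isProbabilityMeasure_map hexp.aemeasurable
  have hmem : ∀ y : ℝ, 0 ≤ y → Real.exp (-y) ∈ Icc (0 : ℝ) 1 := fun y hy =>
    ⟨(Real.exp_pos _).le, Real.exp_le_one_iff.2 (by linarith)⟩
  have hint : ∀ (T : ℝ) (f : ℝ → ℝ), ∫ t, f t ∂(u T) = (max T 1)⁻¹ * ∫ t in (0 : ℝ)..max T 1, f t :=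
    fun T f => by
      simp only [hu]
      rw [integral_smul_measure, ENNReal.toReal_ofReal (inv_nonneg.2 (hmax T).le),
        intervalIntegral.integral_of_le (hmax T).le, smul_eq_mul]
  have hev : ∀ᶠ T : ℝ in atTop, max T 1 = T :=
    (eventually_ge_atTop 1).mono fun T hT => max_eq_left hT
  have hpre : ∀ y, Real.exp (-x) ≤ Real.exp (-y) ↔ y ≤ x := fun y => by
    rw [Real.exp_le_exp, neg_le_neg_iff]
  have h := tendsto_real_Ici_of_tendsto_moments (l := atTop) (m := m)
    (ν := ν.map fun x => Real.exp (-x)) (fun T => ?_) ?_ (fun k => ?_) (a := Real.exp (-x)) ?_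
  · have h1 : (ν.map fun x => Real.exp (-x)).real (Ici (Real.exp (-x))) = ν.real (Iic x) := by
      rw [map_measureReal_apply hexp measurableSet_Ici]
      congr 1
      ext y
      exact hpre y
    rw [h1] at h
    refine h.congr' ?_
    filter_upwards [hev] with T hT
    have h2 := hint T (indicator {t | B t ≤ x} fun _ => 1)
    rw [hT] at h2
    rw [← h2, integral_indicator (show MeasurableSet {t | B t ≤ x} from hB measurableSet_Iic)]
    simp only [integral_const, smul_eq_mul, mul_one, measureReal_restrict_apply_univ, hm]
    rw [map_measureReal_apply hE measurableSet_Ici]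
    congr 1
    ext y
    exact hpre (B y)
  · simp only [hm]
    rw [ae_map_iff hE.aemeasurable (p := fun y => y ∈ Icc (0 : ℝ) 1) measurableSet_Icc]
    refine Measure.ae_smul_measure ?_ _
    filter_upwards [ae_restrict_mem measurableSet_Ioc] with t ht using hmem _ (hB0 t ht.1.le)
  · rw [ae_map_iff hexp.aemeasurable (p := fun y => y ∈ Icc (0 : ℝ) 1) measurableSet_Icc]
    exact hν0.mono hmem
  · have hk : ∀ y : ℝ, Real.exp (-y) ^ k = Real.exp (-k * y) := fun y => by
      rw [← Real.exp_nat_mul]; ring_nf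
    rw [integral_map hexp.aemeasurable (by fun_prop)]
    simp_rw [hk]
    refine (hlim k).congr' ?_
    filter_upwards [hev] with T hT
    simp only [hm]
    rw [integral_map hE.aemeasurable (by fun_prop), hint]
    simp_rw [hk]
    rw [hT]
  · rw [Measure.map_apply hexp (measurableSet_singleton _)]
    convert hνa x using 2
    ext y
    simp

end Moments

/-! ### Uniqueness of a time-invariant law -/

section TimeInvariance

variable {Ω : Type*} [MeasurableSpace Ω] {P : Measure Ω} [IsProbabilityMeasure P]

/-- By Fubini the expected time average equals the constant probability; by dominated convergence it
tends to that of `ν`. -/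
theorem map_eq_of_tendsto_average_indicator {A : ℝ → Ω → ℝ} (hA : Measurable (Function.uncurry A))
    {ν : Measure ℝ} [IsProbabilityMeasure ν]
    (hlim : ∀ᵐ ω ∂P, ∀ x : ℝ, Tendsto
        (fun T : ℝ => T⁻¹ * ∫ t in (0 : ℝ)..T, indicator {t | A t ω ≤ x} (fun _ => (1 : ℝ)) t)
        atTop (𝓝 (ν.real (Iic x))))
    (hinv : ∀ t, 0 ≤ t → P.map (A t) = P.map (A 0)) : P.map (A 0) = ν := by
  have hAt : ∀ t, Measurable (A t) := fun t => hA.comp measurable_prodMk_left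
  have hprob : IsProbabilityMeasure (P.map (A 0)) :=
    Measure.isProbabilityMeasure_map (hAt 0).aemeasurable
  refine Measure.ext_of_Iic _ _ fun x => ?_
  set q : ℝ × Ω → ℝ := indicator {p | A p.1 p.2 ≤ x} fun _ => 1 with hq
  have hset : MeasurableSet {p : ℝ × Ω | A p.1 p.2 ≤ x} := hA measurableSet_Iic
  have hqm : Measurable q := measurable_const.indicator hset
  have hq1 : ∀ p, ‖q p‖ ≤ 1 := fun p => by
    simp only [hq, indicator]; split_ifs <;> simp
  have hqP : ∀ t, 0 ≤ t → ∫ ω, q (t, ω) ∂P = (P.map (A 0)).real (Iic x) := fun t ht => by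
    have : (fun ω => q (t, ω)) = indicator (A t ⁻¹' Iic x) fun _ => 1 := rfl
    rw [this, integral_indicator ((hAt t) measurableSet_Iic), ← hinv t ht,
      map_measureReal_apply (hAt t) measurableSet_Iic]
    simp
  set F : ℕ → Ω → ℝ := fun n ω => ((n + 1 : ℕ) : ℝ)⁻¹ * ∫ t in Ioc (0 : ℝ) (n + 1 : ℕ), q (t, ω)
    with hF
  have hFm : ∀ n, AEStronglyMeasurable (F n) P := fun n =>
    ((hqm.stronglyMeasurable.integral_prod_left'
      (μ := volume.restrict (Ioc (0 : ℝ) (n + 1 : ℕ)))).const_mul _).aestronglyMeasurable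
  have hFb : ∀ n ω, ‖F n ω‖ ≤ 1 := fun n ω => by
    have h := norm_setIntegral_le_of_norm_le_const (μ := volume) (s := Ioc (0 : ℝ) (n + 1 : ℕ))
      (f := fun t => q (t, ω)) (C := 1) (by simp) fun t _ => hq1 _
    rw [Real.volume_real_Ioc_of_le (by positivity), sub_zero, one_mul] at h
    simp only [hF]
    rw [norm_mul, norm_inv, Real.norm_natCast]
    exact (mul_le_mul_of_nonneg_left h (by positivity)).trans_eq
      (inv_mul_cancel₀ (by positivity))
  have hFP : ∀ n, ∫ ω, F n ω ∂P = (P.map (A 0)).real (Iic x) := fun n => by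
    have hfin : IsFiniteMeasure (volume.restrict (Ioc (0 : ℝ) (n + 1 : ℕ))) := ⟨by simp⟩
    have hi : Integrable (Function.uncurry fun (ω : Ω) (t : ℝ) => q (t, ω))
        (P.prod (volume.restrict (Ioc (0 : ℝ) (n + 1 : ℕ)))) :=
      Integrable.of_bound (hqm.comp measurable_swap).aestronglyMeasurable 1
        (Eventually.of_forall fun p => hq1 _)
    simp only [hF]
    rw [integral_const_mul, integral_integral_swap hi,
      setIntegral_congr_fun measurableSet_Ioc fun t ht => hqP t ht.1.le, setIntegral_const,
      Real.volume_real_Ioc_of_le (by positivity), sub_zero, smul_eq_mul, ← mul_assoc,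
      inv_mul_cancel₀ (by positivity), one_mul]
  have hcast : Tendsto (fun n : ℕ => ((n + 1 : ℕ) : ℝ)) atTop atTop :=
    tendsto_natCast_atTop_atTop.comp (tendsto_add_atTop_nat 1)
  have hconv := tendsto_integral_of_dominated_convergence (μ := P) (F := F)
    (f := fun _ => ν.real (Iic x)) (fun _ => 1) hFm (integrable_const 1)
    (fun n => Eventually.of_forall (hFb n)) (hlim.mono fun ω hω => by
      refine ((hω x).comp hcast).congr fun n => ?_
      rw [Function.comp_apply, intervalIntegral.integral_of_le (by positivity)]
      rfl)
  simp only [hFP, integral_const, probReal_univ, one_smul] at hconv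
  have := tendsto_nhds_unique tendsto_const_nhds hconv
  rwa [measureReal_def, measureReal_def,
    ENNReal.toReal_eq_toReal_iff' (measure_ne_top _ _) (measure_ne_top _ _)] at this

end TimeInvariance

/-! ### Joint measurability of the age and of the time to the next informative packet -/

section PathMeasurability

variable {Ω : Type*} [MeasurableSpace Ω] {e τ : Ω → ℝ} {G H : ℕ → Ω → ℝ}

theorem measurable_arrival (hτ : Measurable τ) (hG : ∀ n, Measurable (G n)) (n : ℕ) :
    Measurable fun ω => arrival (τ ω) (fun m => G m ω) n :=
  hτ.add (Finset.measurable_sum _ fun i _ => hG i)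

theorem measurable_departure (hτ : Measurable τ) (hG : ∀ n, Measurable (G n))
    (hH : ∀ n, Measurable (H n)) (n : ℕ) :
    Measurable fun ω => departure (τ ω) (fun m => G m ω) (fun m => H m ω) n :=
  (measurable_arrival hτ hG n).add (hH n)

theorem measurableSet_informative (hτ : Measurable τ) (hG : ∀ n, Measurable (G n))
    (hH : ∀ n, Measurable (H n)) (n : ℕ) :
    MeasurableSet {ω | Informative (τ ω) (fun m => G m ω) (fun m => H m ω) n} :=
  measurableSet_le (measurable_departure hτ hG hH n) (measurable_arrival hτ hG (n + 1))

theorem measurable_uncurry_ageOfInformation (he : Measurable e) (hτ : Measurable τ)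
    (hG : ∀ n, Measurable (G n)) (hH : ∀ n, Measurable (H n)) (hH0 : ∀ n ω, 0 ≤ H n ω) :
    Measurable (Function.uncurry fun (t : ℝ) (ω : Ω) =>
      ageOfInformation (e ω) (τ ω) (fun n => G n ω) (fun n => H n ω) t) := by
  refine measurable_fst.sub (measurable_of_Ioi fun a => ?_)
  have : ((fun p : ℝ × Ω => displayedStamp (e p.2) (τ p.2) (fun n => G n p.2)
      (fun n => H n p.2) p.1) ⁻¹' Ioi a) = {p | a < e p.2} ∪ ⋃ n : ℕ,
        {p | Informative (τ p.2) (fun n => G n p.2) (fun n => H n p.2) n} ∩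
          ({p | departure (τ p.2) (fun n => G n p.2) (fun n => H n p.2) n ≤ p.1} ∩
          {p | a < arrival (τ p.2) (fun n => G n p.2) n}) := by
    ext p
    simp only [mem_preimage, mem_Ioi, mem_union, mem_iUnion, mem_inter_iff, mem_ofPred_eq,
      displayedStamp]
    rw [lt_csSup_iff ⟨_, bddAbove_stamps (fun n => hH0 n p.2) p.1⟩ (insert_nonempty _ _)]
    constructor
    · rintro ⟨y, rfl | ⟨n, hi, hd, rfl⟩, hy⟩
      · exact Or.inl hy
      · exact Or.inr ⟨n, hi, hd, hy⟩
    · rintro (hy | ⟨n, hi, hd, hy⟩)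
      · exact ⟨_, Or.inl rfl, hy⟩
      · exact ⟨_, Or.inr ⟨n, hi, hd, rfl⟩, hy⟩
  rw [this]
  refine (measurableSet_lt measurable_const (he.comp measurable_snd)).union
    (MeasurableSet.iUnion fun n => ?_)
  refine (measurable_snd (measurableSet_informative hτ hG hH n)).inter (MeasurableSet.inter ?_ ?_)
  · exact measurableSet_le ((measurable_departure hτ hG hH n).comp measurable_snd) measurable_fst
  · exact measurableSet_lt measurable_const ((measurable_arrival hτ hG n).comp measurable_snd)

theorem measurable_timeToInformative (hτ : Measurable τ)
    (hG : ∀ n, Measurable (G n)) (hH : ∀ n, Measurable (H n)) (n : ℕ) :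
    Measurable fun ω => timeToInformative (τ ω) (fun m => G m ω) (fun m => H m ω) n := by
  have hN : Measurable fun ω =>
      sInf {k | n ≤ k ∧ Informative (τ ω) (fun m => G m ω) (fun m => H m ω) k} := by
    refine measurable_of_Iic fun k => ?_
    -- The intersection accounts for paths with no informative packet from `n` on, where `sInf`
    -- takes the default value `0`.
    have : ((fun ω => sInf {k | n ≤ k ∧ Informative (τ ω) (fun m => G m ω) (fun m => H m ω) k}) ⁻¹'
        Iic k) = (⋃ j : ℕ, {ω | (n ≤ j ∧ j ≤ k) ∧
          Informative (τ ω) (fun m => G m ω) (fun m => H m ω) j}) ∪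
        ⋂ j : ℕ, {ω | n ≤ j ∧ Informative (τ ω) (fun m => G m ω) (fun m => H m ω) j}ᶜ := by
      ext ω
      simp only [mem_preimage, mem_Iic, mem_union, mem_iUnion, mem_iInter, mem_compl_iff,
        mem_ofPred_eq]
      set S := {k | n ≤ k ∧ Informative (τ ω) (fun m => G m ω) (fun m => H m ω) k} with hS
      rcases S.eq_empty_or_nonempty with h | h
      · rw [h, Nat.sInf_empty]
        refine ⟨fun _ => Or.inr fun j hj => ?_, fun _ => Nat.zero_le _⟩
        have : j ∈ S := hj
        rw [h] at this
        exact this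
      · constructor
        · intro hk
          have hmem := Nat.sInf_mem h
          exact Or.inl ⟨sInf S, ⟨hmem.1, hk⟩, hmem.2⟩
        · rintro (⟨j, ⟨h1, h2⟩, h3⟩ | hno)
          · exact (Nat.sInf_le (show j ∈ S from ⟨h1, h3⟩)).trans h2
          · obtain ⟨j, hj⟩ := h
            exact absurd hj (hno j)
    rw [this]
    have hi := measurableSet_informative hτ hG hH
    exact (MeasurableSet.iUnion fun j => (MeasurableSet.const _).inter (hi j)).union
      (MeasurableSet.iInter fun j => ((MeasurableSet.const _).inter (hi j)).compl)
  have harr : Measurable fun p : ℕ × Ω => arrival (τ p.2) (fun m => G m p.2) p.1 :=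
    measurable_from_prod_countable_right fun k => measurable_arrival hτ hG k
  exact (harr.comp (hN.prodMk measurable_id)).sub (measurable_arrival hτ hG n)

end PathMeasurability
-- The law of the time to the next informative packet
section TimeToInformative

theorem timeToInformative_eq_sum {τ : ℝ} {g h : ℕ → ℝ} {n j : ℕ}
    (hlt : ∀ i < j, g (n + i) < h (n + i)) (hj : h (n + j) ≤ g (n + j)) :
    timeToInformative τ g h n = ∑ i ∈ Finset.range j, g (n + i) := by
  have hinf : sInf {k | n ≤ k ∧ Informative τ g h k} = n + j := by
    refine IsLeast.csInf_eq ⟨⟨by omega, (informative_iff _).2 hj⟩, ?_⟩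
    rintro k ⟨hk, hik⟩
    by_contra hcon
    have := hlt (k - n) (by omega)
    rw [show n + (k - n) = k by omega] at this
    exact not_lt.2 ((informative_iff _).1 hik) this
  rw [timeToInformative, hinf, arrival, arrival, Finset.sum_range_add]
  ring

variable {Ω : Type*} [MeasurableSpace Ω] {P : Measure Ω} [IsProbabilityMeasure P]
  {μG μH : Measure ℝ} [IsProbabilityMeasure μG] [IsProbabilityMeasure μH]

omit [IsProbabilityMeasure P] in
theorem integral_prod_range_mul {S : Type*} [MeasurableSpace S] {X : ℕ → Ω → S} {ρ : Measure S}
    (hX : ∀ n, Measurable (X n)) (hind : iIndepFun X P) (hlaw : ∀ n, P.map (X n) = ρ)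
    {𝕜 : Type*} [RCLike 𝕜] {f k : S → 𝕜} (hf : Measurable f) (hk : Measurable k) (m j : ℕ) :
    ∫ ω, (∏ i ∈ Finset.range j, f (X (m + i) ω)) * k (X (m + j) ω) ∂P =
      (∫ x, f x ∂ρ) ^ j * ∫ x, k x ∂ρ := by
  have hY : iIndepFun (fun i : Fin (j + 1) => X (m + i)) P :=
    hind.precomp (g := fun i : Fin (j + 1) => m + (i : ℕ)) fun a b hab => by
      apply Fin.ext; simpa using hab
  have hmF : ∀ i : Fin (j + 1), Measurable (if (i : ℕ) < j then f else k) := fun i => by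
    split_ifs
    · exact hf
    · exact hk
  have h := hY.integral_fun_prod_comp
    (f := fun i : Fin (j + 1) => if (i : ℕ) < j then f else k)
    (fun i => (hX _).aemeasurable) (fun i => (hmF i).aestronglyMeasurable)
  have hint : ∀ i : Fin (j + 1), ∫ ω, (if (i : ℕ) < j then f else k) (X (m + i) ω) ∂P =
      if (i : ℕ) < j then ∫ x, f x ∂ρ else ∫ x, k x ∂ρ := fun i => by
    rw [← integral_map (hX _).aemeasurable (hmF i).aestronglyMeasurable, hlaw]
    split_ifs <;> rfl
  simp_rw [hint] at h
  simp only [Fin.prod_univ_castSucc, Fin.val_castSucc, Fin.is_lt, if_true, Fin.val_last,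
    lt_irrefl, if_false, Finset.prod_const, Finset.card_univ, Fintype.card_fin] at h
  rw [← h]
  refine integral_congr_ae (Eventually.of_forall fun ω => ?_)
  simp only [Finset.prod_range]

/-- Decompose the characteristic function according to the number `j` of preempted packets before
the first informative one. By independence the `j`-th term is `(ζ * charFun (lawGltH μG μH) t) ^ j *
(1 - ζ)`, and the geometric series is that of the compound law. -/
theorem map_timeToInformative {τ : Ω → ℝ} {G H : ℕ → Ω → ℝ} (hτ : Measurable τ)
    (hG : ∀ n, Measurable (G n)) (hH : ∀ n, Measurable (H n))
    (hlaw : ∀ n, P.map (fun ω => (G (n + 1) ω, H (n + 1) ω)) = μG.prod μH)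
    (hind : iIndepFun (fun (n : ℕ) (ω : Ω) => (G (n + 1) ω, H (n + 1) ω)) P)
    (hG0 : ∀ᵐ x ∂μG, 0 ≤ x)
    (hζ0 : 0 < preemptProb μG μH) (hζ1 : preemptProb μG μH < 1) (m : ℕ) :
    P.map (fun ω => timeToInformative (τ ω) (fun i => G i ω) (fun i => H i ω) (m + 1)) =
      geometricCompound (preemptProb μG μH) (lawGltH μG μH) := by
  have := isProbabilityMeasure_lawGltH hζ0
  have := isProbabilityMeasure_geometricCompound (μ := lawGltH μG μH) hζ0.le hζ1
  have hZ := measurable_timeToInformative hτ hG hH (m + 1)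
  have := Measure.isProbabilityMeasure_map (μ := P) hZ.aemeasurable
  set X : ℕ → Ω → ℝ × ℝ := fun n ω => (G (n + 1) ω, H (n + 1) ω) with hXdef
  have hX : ∀ n, Measurable (X n) := fun n => (hG _).prodMk (hH _)
  refine Measure.ext_of_charFun (funext fun t => ?_)
  rw [charFun_geometricCompound
    (ae_lawGltH (q := fun x => 0 ≤ x) measurableSet_Ici (ae_fst_of_ae hG0)) hζ0.le hζ1,
    charFun_apply_real, integral_map hZ.aemeasurable (by fun_prop)]
  set ζ := preemptProb μG μH with hζ
  set f : ℝ × ℝ → ℂ := {p : ℝ × ℝ | p.1 < p.2}.indicator fun p => Complex.exp (t * p.1 * Complex.I)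
    with hf
  set k : ℝ × ℝ → ℂ := {p : ℝ × ℝ | p.1 < p.2}ᶜ.indicator fun _ => 1 with hk
  have mf : Measurable f := Measurable.indicator (by fun_prop) measurableSet_fst_lt_snd
  have mk : Measurable k := Measurable.indicator (by fun_prop) measurableSet_fst_lt_snd.compl
  have nf : ∀ p, ‖f p‖ = {p : ℝ × ℝ | p.1 < p.2}.indicator (fun _ => (1 : ℝ)) p := fun p => by
    rw [hf, norm_indicator_eq_indicator_norm]
    congr 1
    funext q
    rw [← Complex.ofReal_mul, Complex.norm_exp_ofReal_mul_I]
  have nk : ∀ p, ‖k p‖ = {p : ℝ × ℝ | p.1 < p.2}ᶜ.indicator (fun _ => (1 : ℝ)) p := fun p => by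
    rw [hk, norm_indicator_eq_indicator_norm]
    simp
  have if' : ∫ p, f p ∂(μG.prod μH) = ζ * charFun (lawGltH μG μH) t := by
    rw [hf, integral_indicator measurableSet_fst_lt_snd, charFun_apply_real,
      ← integral_lawGltH hζ0 (f := fun x : ℝ => Complex.exp (t * x * Complex.I))
        (Measurable.stronglyMeasurable (by fun_prop)), Complex.real_smul]
  have ik : ∫ p, k p ∂(μG.prod μH) = 1 - ζ := by
    rw [hk, integral_indicator measurableSet_fst_lt_snd.compl, setIntegral_const,
      probReal_compl_eq_one_sub measurableSet_fst_lt_snd]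
    simp [hζ, preemptProb]
  have inf' : ∫ p, ‖f p‖ ∂(μG.prod μH) = ζ := by
    simp_rw [nf]
    rw [integral_indicator measurableSet_fst_lt_snd, setIntegral_const]
    simp [hζ, preemptProb]
  have ink : ∫ p, ‖k p‖ ∂(μG.prod μH) = 1 - ζ := by
    simp_rw [nk]
    rw [integral_indicator measurableSet_fst_lt_snd.compl, setIntegral_const,
      probReal_compl_eq_one_sub measurableSet_fst_lt_snd]
    simp [hζ, preemptProb]
  -- Contribution of the event that exactly `j` preempted packets come first; for almost every path
  -- exactly one `F j` is nonzero.
  set F : ℕ → Ω → ℂ := fun j ω =>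
    (∏ i ∈ Finset.range j, f (X (m + i) ω)) * k (X (m + j) ω) with hF
  have mF : ∀ j, Measurable (F j) := fun j =>
    (Finset.measurable_prod _ fun i _ => mf.comp (hX _)).mul (mk.comp (hX _))
  have nF : ∀ j, ∫ ω, ‖F j ω‖ ∂P = ζ ^ j * (1 - ζ) := fun j => by
    rw [← ink, ← inf', ← integral_prod_range_mul hX hind hlaw mf.norm mk.norm m j]
    simp only [hF, norm_mul, norm_prod]
  have bF : ∀ j ω, ‖F j ω‖ ≤ 1 := fun j ω => by
    simp only [hF, norm_mul, norm_prod]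
    refine mul_le_one₀ (Finset.prod_le_one (fun _ _ => norm_nonneg _) fun i _ => ?_)
      (norm_nonneg _) ?_
    · rw [nf]; simp only [indicator]; split_ifs <;> simp
    · rw [nk]; simp only [indicator]; split_ifs <;> simp
  have hsum := hasSum_integral_of_summable_integral_norm (μ := P) (F := F)
    (fun j => Integrable.of_bound (mF j).aestronglyMeasurable 1 (Eventually.of_forall (bF j)))
    (by
      simp_rw [nF]
      exact (summable_geometric_of_lt_one hζ0.le hζ1).mul_right _)
  have hFint : ∀ j, ∫ ω, F j ω ∂P = (ζ * charFun (lawGltH μG μH) t) ^ j * (1 - ζ) := fun j => by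
    rw [← if', ← ik, ← integral_prod_range_mul hX hind hlaw mf mk m j]
  have hr : ‖(ζ : ℂ) * charFun (lawGltH μG μH) t‖ < 1 := by
    rw [norm_mul, Complex.norm_real, Real.norm_of_nonneg hζ0.le]
    exact (mul_le_of_le_one_right hζ0.le (norm_charFun_le_one t)).trans_lt hζ1
  have htot : ∫ ω, ∑' j, F j ω ∂P = (1 - (ζ : ℂ)) / (1 - ζ * charFun (lawGltH μG μH) t) := by
    rw [← hsum.tsum_eq]
    simp_rw [hFint]
    rw [tsum_mul_right, tsum_geometric_of_norm_lt_one hr, div_eq_mul_inv, mul_comm]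
  rw [← htot]
  refine integral_congr_ae ?_
  filter_upwards [ae_frequently_informative hX hind hlaw hζ1] with ω hω
  have hex : ∃ j, (X (m + j) ω).2 ≤ (X (m + j) ω).1 := by
    obtain ⟨n, hn, h⟩ := (hω.and_eventually (eventually_ge_atTop m)).exists
    exact ⟨n - m, by rwa [Nat.add_sub_cancel' h]⟩
  classical
  set J := Nat.find hex with hJ
  have hJspec : (X (m + J) ω).2 ≤ (X (m + J) ω).1 := Nat.find_spec hex
  have hJmin : ∀ i < J, (X (m + i) ω).1 < (X (m + i) ω).2 := fun i hi =>
    not_le.1 (Nat.find_min hex hi)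
  have hshift : ∀ i, m + 1 + i = m + i + 1 := fun i => by omega
  have hT : timeToInformative (τ ω) (fun i => G i ω) (fun i => H i ω) (m + 1) =
      ∑ i ∈ Finset.range J, (X (m + i) ω).1 := by
    rw [timeToInformative_eq_sum (j := J)]
    · exact Finset.sum_congr rfl fun i _ => by rw [hshift]
    · intro i hi
      simp only [hshift]
      exact hJmin i hi
    · simp only [hshift]
      exact hJspec
  have hzero : ∀ j, j ≠ J → F j ω = 0 := fun j hj => by
    simp only [hF]
    rcases lt_or_gt_of_ne hj with h | h
    · have : k (X (m + j) ω) = 0 :=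
        indicator_of_notMem (s := ({p : ℝ × ℝ | p.1 < p.2}ᶜ : Set (ℝ × ℝ)))
          (notMem_compl_iff.2 (hJmin j h)) _
      rw [this, mul_zero]
    · have : f (X (m + J) ω) = 0 :=
        indicator_of_notMem (s := {p : ℝ × ℝ | p.1 < p.2}) (not_lt.2 hJspec) _
      rw [Finset.prod_eq_zero (Finset.mem_range.2 h) this, zero_mul]
  rw [tsum_eq_single J hzero, hT]
  simp only [hF]
  have h1 : k (X (m + J) ω) = 1 :=
    indicator_of_mem (s := ({p : ℝ × ℝ | p.1 < p.2}ᶜ : Set (ℝ × ℝ))) (not_lt.2 hJspec) _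
  rw [h1, mul_one, Complex.ofReal_sum, Finset.mul_sum, Finset.sum_mul, Complex.exp_sum]
  refine Finset.prod_congr rfl fun i hi => ?_
  have h2 : f (X (m + i) ω) = Complex.exp (t * (X (m + i) ω).1 * Complex.I) :=
    indicator_of_mem (s := {p : ℝ × ℝ | p.1 < p.2}) (hJmin i (Finset.mem_range.1 hi)) _
  exact h2.symm

end TimeToInformative

/-! ### Nonnegativity of the marginals and positivity of the mean interarrival time -/

section Positivity

variable {Ω : Type*} [MeasurableSpace Ω] {P : Measure Ω}
  {μG μH : Measure ℝ} [IsProbabilityMeasure μG] [IsProbabilityMeasure μH]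

theorem ae_nonneg_marginals {G H : Ω → ℝ} (hG : Measurable G) (hH : Measurable H)
    (hG0 : ∀ ω, 0 ≤ G ω) (hH0 : ∀ ω, 0 ≤ H ω)
    (hlaw : P.map (fun ω => (G ω, H ω)) = μG.prod μH) :
    (∀ᵐ x ∂μG, 0 ≤ x) ∧ ∀ᵐ x ∂μH, 0 ≤ x := by
  have h1 : P.map G = μG := by
    have := congrArg Measure.fst hlaw
    rwa [Measure.fst_map_prodMk hH, Measure.fst_prod] at this
  have h2 : P.map H = μH := by
    have := congrArg Measure.snd hlaw
    rwa [Measure.snd_map_prodMk hG, Measure.snd_prod] at this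
  constructor
  · rw [← h1, ae_map_iff hG.aemeasurable measurableSet_Ici]
    exact Eventually.of_forall hG0
  · rw [← h2, ae_map_iff hH.aemeasurable measurableSet_Ici]
    exact Eventually.of_forall hH0

/-- If the mean vanished, `G` would be zero almost surely and `H < G` would be null, contradicting
`ζ < 1` in the absence of ties. -/
theorem integral_id_pos (hG : Integrable (fun x : ℝ => x) μG) (hG0 : ∀ᵐ x ∂μG, 0 ≤ x)
    (hH0 : ∀ᵐ x ∂μH, 0 ≤ x) (htie : (μG.prod μH) {p | p.1 = p.2} = 0)
    (hζ1 : preemptProb μG μH < 1) : 0 < ∫ x, x ∂μG := by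
  refine lt_of_le_of_ne (integral_nonneg_of_ae hG0) fun h => ?_
  have hz := (integral_eq_zero_iff_of_nonneg_ae hG0 hG).1 h.symm
  have hnull : (μG.prod μH) {p | p.2 < p.1} = 0 := by
    rw [measure_eq_zero_iff_ae_notMem]
    filter_upwards [ae_fst_of_ae (μH := μH) hz, ae_snd_of_ae (μG := μG) hH0] with p h1 h2
    simp only [Pi.zero_apply] at h1
    simp only [not_lt, h1]
    exact h2
  have := real_snd_lt_fst htie
  rw [measureReal_def, hnull, ENNReal.toReal_zero] at this
  linarith

end Positivity
-- The stationary age of information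
theorem theorem6 {Ω : Type*} [MeasurableSpace Ω] (P : Measure Ω) [IsProbabilityMeasure P]
    -- laws of the interarrival times and of the service times
    (μG μH : Measure ℝ) [IsProbabilityMeasure μG] [IsProbabilityMeasure μH]
    (hGint : Integrable (fun x : ℝ => x) μG)
    (htie : (μG.prod μH) {p | p.1 = p.2} = 0)
    (hζ_pos : 0 < preemptProb μG μH) (hζ_lt : preemptProb μG μH < 1)
    -- the queue: arbitrary initial data `e`, `τ`, `G 0`, `H 0`, and afterwards i.i.d.
    -- interarrival times and i.i.d. service times, independent of each other
    (e τ : Ω → ℝ) (G H : ℕ → Ω → ℝ)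
    (he_meas : Measurable e) (hτ_meas : Measurable τ)
    (hG_meas : ∀ n, Measurable (G n)) (hH_meas : ∀ n, Measurable (H n))
    (he_nonpos : ∀ ω, e ω ≤ 0)
    (hG_nonneg : ∀ n ω, 0 ≤ G n ω) (hH_nonneg : ∀ n ω, 0 ≤ H n ω)
    (hlaw : ∀ n, P.map (fun ω => (G (n + 1) ω, H (n + 1) ω)) = μG.prod μH)
    (hindep : iIndepFun (fun (n : ℕ) (ω : Ω) => (G (n + 1) ω, H (n + 1) ω)) P)
    -- its age-of-information process
    (A : ℝ → Ω → ℝ)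
    (hA : ∀ t ω, A t ω = ageOfInformation (e ω) (τ ω) (fun n => G n ω) (fun n => H n ω) t) :
    -- the stationary law `ν` of the age of information
    ∃ ν : Measure ℝ, IsProbabilityMeasure ν ∧
      -- it is the long-run fraction of time
      (∀ᵐ ω ∂P, ∀ x : ℝ, Tendsto
        (fun T : ℝ => T⁻¹ * ∫ t in (0 : ℝ)..T, indicator {t | A t ω ≤ x} (fun _ => (1 : ℝ)) t)
        atTop (𝓝 (ν.real (Iic x)))) ∧
      -- and the law of the age at every time if the initial data make that law time-invariant
      ((∀ t, 0 ≤ t → P.map (A t) = P.map (A 0)) → ∀ t, 0 ≤ t → P.map (A t) = ν) ∧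
      -- Laplace-Stieltjes transform
      (∀ s : ℝ, 0 < s →
        lst ν s = lst (lawHltG μG μH) s * lst (residualLaw μG) s *
          ((1 - preemptProb μG μH) / (1 - preemptProb μG μH * lst (lawGltH μG μH) s)) ∧
        lst (residualLaw μG) s = (1 - lst μG s) / (s * ∫ x, x ∂μG)) ∧
      -- mean, also as a long-run average
      (Integrable (fun x : ℝ => x ^ 2) μG →
        Integrable (fun x : ℝ => x) ν ∧
        (∫ x, x ∂ν) = (∫ x, x ∂(lawHltG μG μH)) + (∫ x, x ^ 2 ∂μG) / (2 * (∫ x, x ∂μG)) +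
          preemptProb μG μH / (1 - preemptProb μG μH) * (∫ x, x ∂(lawGltH μG μH)) ∧
        ∀ᵐ ω ∂P, Tendsto (fun T : ℝ => T⁻¹ * ∫ t in (0 : ℝ)..T, A t ω)
          atTop (𝓝 (∫ x, x ∂ν))) ∧
      -- decomposition into independent summands `H_{<G}`, the residual time, and `Z`
      ν = ((lawHltG μG μH).conv (residualLaw μG)).conv
        (geometricCompound (preemptProb μG μH) (lawGltH μG μH)) ∧
      -- `Z`: the time from the arrival of a packet to that of the next informative one
      (∀ n, 1 ≤ n → P.map
          (fun ω => timeToInformative (τ ω) (fun m => G m ω) (fun m => H m ω) n) =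
        geometricCompound (preemptProb μG μH) (lawGltH μG μH)) ∧
      (∀ s : ℝ, 0 < s → lst (geometricCompound (preemptProb μG μH) (lawGltH μG μH)) s =
        (1 - preemptProb μG μH) / (1 - preemptProb μG μH * lst (lawGltH μG μH) s)) := by
  have hX : ∀ n, Measurable fun ω => (G (n + 1) ω, H (n + 1) ω) := fun n =>
    (hG_meas _).prodMk (hH_meas _)
  obtain ⟨hG0, hH0⟩ := ae_nonneg_marginals (hG_meas 1) (hH_meas 1) (hG_nonneg 1) (hH_nonneg 1)
    (hlaw 0)
  have hEG := integral_id_pos hGint hG0 hH0 htie hζ_lt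
  have pHG := isProbabilityMeasure_lawHltG htie hζ_lt
  have pGH := isProbabilityMeasure_lawGltH hζ_pos
  have pR := isProbabilityMeasure_residualLaw hG0 hGint hEG
  have pZ := isProbabilityMeasure_geometricCompound (μ := lawGltH μG μH) hζ_pos.le hζ_lt
  have hHG0 : ∀ᵐ x ∂(lawHltG μG μH), 0 ≤ x :=
    ae_lawHltG (q := fun x => 0 ≤ x) measurableSet_Ici (ae_snd_of_ae hH0)
  have hGH0 : ∀ᵐ x ∂(lawGltH μG μH), 0 ≤ x :=
    ae_lawGltH (q := fun x => 0 ≤ x) measurableSet_Ici (ae_fst_of_ae hG0)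
  set ν := ((lawHltG μG μH).conv (residualLaw μG)).conv
    (geometricCompound (preemptProb μG μH) (lawGltH μG μH)) with hν
  have hlstZ : ∀ s : ℝ, 0 < s → lst (geometricCompound (preemptProb μG μH) (lawGltH μG μH)) s =
      (1 - preemptProb μG μH) / (1 - preemptProb μG μH * lst (lawGltH μG μH) s) := fun s hs =>
    lst_geometricCompound hGH0 hζ_pos.le hζ_lt hs.le
  have hlst : ∀ s : ℝ, 0 < s → lst ν s = lst (lawHltG μG μH) s * lst (residualLaw μG) s *
      ((1 - preemptProb μG μH) / (1 - preemptProb μG μH * lst (lawGltH μG μH) s)) := fun s hs => by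
    rw [hν, lst_conv, lst_conv, hlstZ s hs]
  have hν0 : ∀ᵐ x ∂ν, 0 ≤ x :=
    ae_nonneg_conv (ae_nonneg_conv hHG0 ae_nonneg_residualLaw) (ae_nonneg_geometricCompound hGH0)
  have hνa : ∀ x, ν {x} = 0 := fun x => by
    -- Commuting moves the factor containing the residual law to the second place, where
    -- atomlessness is required.
    rw [hν, Measure.conv_comm]
    exact conv_singleton_eq_zero (conv_singleton_eq_zero residualLaw_singleton) x
  obtain rfl : A = fun t ω =>
      ageOfInformation (e ω) (τ ω) (fun n => G n ω) (fun n => H n ω) t :=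
    funext fun t => funext fun ω => hA t ω
  have hslln := strong_law_comp hX hindep hlaw measurable_fst (hGint.comp_fst μH)
  rw [integral_fun_fst (fun x : ℝ => x), probReal_univ, one_smul] at hslln
  have hfreq := ae_frequently_informative hX hindep hlaw hζ_lt
  have hlim : ∀ᵐ ω ∂P, ∀ x : ℝ, Tendsto (fun T : ℝ => T⁻¹ * ∫ t in (0 : ℝ)..T,
      indicator {t | ageOfInformation (e ω) (τ ω) (fun n => G n ω) (fun n => H n ω) t ≤ x}
        (fun _ => (1 : ℝ)) t) atTop (𝓝 (ν.real (Iic x))) := by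
    -- Only countably many arguments `k + 1` are used, so one null set serves them all; the case `0`
    -- is trivial and handled separately.
    have hexp := ae_all_iff.2 fun k : ℕ => ae_tendsto_average_reward_exp hX hindep hlaw
      (fun n ω => hG_nonneg (n + 1) ω) hG0 hH0 htie hζ_pos hζ_lt hEG (s := k + 1) (by positivity)
    filter_upwards [hexp, hslln, hfreq] with ω h1 h2 h3
    refine tendsto_average_indicator_of_tendsto_average_exp
      (measurable_ageOfInformation fun n => hH_nonneg n ω)
      (fun t ht => ageOfInformation_nonneg (he_nonpos ω) (fun n => hH_nonneg n ω) ht) hν0 hνa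
      fun k => ?_
    rcases k with _ | k
    · have : (fun T : ℝ => T⁻¹ * ∫ t in (0 : ℝ)..T, Real.exp (-(0 : ℕ) *
          ageOfInformation (e ω) (τ ω) (fun n => G n ω) (fun n => H n ω) t)) =ᶠ[atTop]
          fun _ => 1 := by
        filter_upwards [eventually_gt_atTop 0] with T hT
        simp [hT.ne']
      rw [tendsto_congr' this]
      simp
    · have h := tendsto_average_age (τ := τ ω) (he_nonpos ω) (fun n => hG_nonneg n ω)
        (fun n => hH_nonneg n ω) (φ := fun x => Real.exp (-((k : ℝ) + 1) * x)) (by fun_prop)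
        (fun _ _ => (Real.exp_pos _).le) hEG h3 h2 (h1 k)
      rw [mul_div_cancel_right₀ _ hEG.ne', ← hlst _ (by positivity)] at h
      simpa only [lst, Nat.cast_add, Nat.cast_one] using h
  refine ⟨ν, inferInstance, hlim, fun hinv t ht => ?_, fun s hs => ⟨hlst s hs, ?_⟩, fun h2 => ?_,
    rfl, fun n hn => ?_, hlstZ⟩
  · rw [hinv t ht]
    exact map_eq_of_tendsto_average_indicator
      (measurable_uncurry_ageOfInformation he_meas hτ_meas hG_meas hH_meas hH_nonneg) hlim hinv
  · exact lst_residualLaw hG0 hEG hs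
  · have iH := integrable_id_lawHltG htie hζ_lt hH0 hGint
    obtain ⟨iR, mR⟩ := integral_id_residualLaw hG0 hEG h2
    obtain ⟨iZ, mZ⟩ := integral_id_geometricCompound
      (integrable_id_lawGltH hζ_pos hGint) hζ_pos.le hζ_lt
    have hmean : (∫ x, x ∂ν) = (∫ x, x ∂(lawHltG μG μH)) +
        (∫ x, x ^ 2 ∂μG) / (2 * (∫ x, x ∂μG)) +
          preemptProb μG μH / (1 - preemptProb μG μH) * (∫ x, x ∂(lawGltH μG μH)) := by
      rw [hν, integral_id_conv (integrable_id_conv iH iR) iZ, integral_id_conv iH iR, mR, mZ]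
    refine ⟨integrable_id_conv (integrable_id_conv iH iR) iZ, hmean, ?_⟩
    filter_upwards [ae_tendsto_average_reward_id hX hindep hlaw hG0 hH0 htie hζ_pos hζ_lt hGint
      hEG h2, hslln, hfreq] with ω h1 h3 h4
    have h := tendsto_average_age (τ := τ ω) (he_nonpos ω) (fun n => hG_nonneg n ω)
      (fun n => hH_nonneg n ω) (φ := fun x => x) continuous_id (fun _ h => h) hEG h4 h3 h1
    rwa [mul_div_cancel_right₀ _ hEG.ne', ← hmean] at h
  · obtain ⟨m, rfl⟩ := Nat.exists_eq_add_of_le' hn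
    exact map_timeToInformative hτ_meas hG_meas hH_meas hlaw hindep hG0 hζ_pos hζ_lt m
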